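/- Let $K$ be a field. For a finite simple graph $G$ with vertex set $V$ and edge set $E(G)$, consider the polynomial ring $K[s, t_{e} \mid e \in E(G)]$. For each unordered partition $A|B$ of $V$ (that is, $A \cup B = V$ and $A \cap B = \emptyset$, empty parts allowed) put $$u_{A|B} = s \cdot \prod_{\substack{ij \in E(G) \\ |A \cap \{i,j\}| = 1}} t_{ij},$$ and let $R_G$ be the toric ring associated to the cut ideal of $G$, i.e. the $K$-subalgebra of $K[s, t_e \mid e \in E(G)]$ generated by all the $u_{A|B}$ (equivalently, the image of the homomorphism $\pi_G : K[q_{A|B}] \to K[s, t_e]$, $q_{A|B} \mapsto u_{A|B}$, whose kernel is the cut ideal of $G$), graded so that every $u_{A|B}$ has degree $1$. The ring $R_G$ is called strongly Koszul if for any two distinct elements $u \neq v$ among the generators $u_{A|B}$ the ideal $(u) \cap (v)$ of $R_G$ is generated by its elements of degree $2$. A graph $H$ is a minor of $G$ if, up to isomorphism, $H$ is obtained from $G$ by a finite sequence of edge deletions, edge contractions (loops being dropped and parallel edges identified) and vertex deletions. Then the set of finite simple graphs $G$ such that $R_G$ is strongly Koszul is minor closed: if $G$ and $H$ are finite simple graphs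 (not necessarily connected), $R_G$ is strongly Koszul, and $H$ is a minor of $G$, then $R_H$ is strongly Koszul. -/

import Mathlib

namespace CutToric

/-! ### Minors of simple graphs -/

/-- The simple graph obtained from `G` by contracting `x` and `y` to one vertex, which keeps the
name `x`; loops are dropped and parallel edges are identified. It is used only for edges `xy`. -/
def contract {V : Type*} (G : SimpleGraph V) (x y : V) : SimpleGraph {v : V // v ≠ y} :=
  SimpleGraph.fromRel fun a b => G.Adj a b ∨ ((a : V) = x ∧ G.Adj y b)

/-- `IsMinor H G`: up to isomorphism, `H` is obtained from `G` by finitely many steps, each of which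
deletes an edge, contracts an edge, or deletes a vertex. -/
inductive IsMinor.{u, v} {W : Type v} (H : SimpleGraph W) :
    {V : Type u} → SimpleGraph V → Prop
  | iso {V : Type u} {G : SimpleGraph V} (f : H ≃g G) : IsMinor H G
  | deleteEdge {V : Type u} {G : SimpleGraph V} (e : Sym2 V) (he : e ∈ G.edgeSet)
      (h : IsMinor H (G.deleteEdges {e})) : IsMinor H G
  | contractEdge {V : Type u} {G : SimpleGraph V} (x y : V) (hxy : G.Adj x y)
      (h : IsMinor H (contract G x y)) : IsMinor H G
  | deleteVertex {V : Type u} {G : SimpleGraph V} (x : V)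
      (h : IsMinor H (G.induce {x}ᶜ)) : IsMinor H G

/-! ### The toric ring of the cut ideal -/

/-- The edge `e` is cut by the partition `A | Aᶜ`: exactly one of its two ends lies in `A`. -/
def IsCutBy {V : Type*} (A : Set V) (e : Sym2 V) : Prop :=
  ∃ i j : V, e = s(i, j) ∧ i ∈ A ∧ j ∉ A

open Classical in
/-- The monomial `u_{A|B} = s * ∏ t_{ij}` (with `B = Aᶜ`) in `K[s, t_{ij} | ij ∈ E(G)]`, the product
being over the edges `ij` cut by `A | B`. The variable `s` is `X none`, and `t_e` is `X (some e)`. -/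
noncomputable def cutMonomial (K : Type*) [Field K] {V : Type*} [Fintype V] (G : SimpleGraph V)
    (A : Set V) : MvPolynomial (Option G.edgeSet) K :=
  MvPolynomial.X none *
    ∏ e ∈ Finset.univ.filter (fun e : G.edgeSet => IsCutBy A e.1), MvPolynomial.X (some e)

/-- The ring homomorphism `π_G : K[q] → K[s, T]`, `q_{A|B} ↦ u_{A|B}`. The partition `A | B` is
indexed by its part `A`; since `A` and `Aᶜ` have the same image, this does not change the image of
`π_G`. -/
noncomputable def cutMap (K : Type*) [Field K] {V : Type*} [Fintype V] (G : SimpleGraph V) :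
    MvPolynomial (Set V) K →ₐ[K] MvPolynomial (Option G.edgeSet) K :=
  MvPolynomial.aeval (cutMonomial K G)

/-- The toric ring `R_G`, the image of `π_G`. -/
noncomputable abbrev toricRing (K : Type*) [Field K] {V : Type*} [Fintype V]
    (G : SimpleGraph V) : Subalgebra K (MvPolynomial (Option G.edgeSet) K) :=
  (cutMap K G).range

/-- The element `u_{A|B}` of the toric ring `R_G`. -/
noncomputable def cutGen (K : Type*) [Field K] {V : Type*} [Fintype V] (G : SimpleGraph V)
    (A : Set V) : toricRing K G :=
  (cutMap K G).rangeRestrict (MvPolynomial.X A)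

/-! ### Strongly Koszul semigroup rings -/

/-- For a `K`-algebra `R` graded so that the elements of `S` generate `R` and have degree `1`, the
ideal `I` is generated by its elements of degree `d`; the component of degree `d` of `R` is the
`K`-span of the `d`-fold products of elements of `S`. -/
def GeneratedInDegree (K : Type*) [Field K] {R : Type*} [CommRing R] [Algebra K R] (S : Set R)
    (d : ℕ) (I : Ideal R) : Prop :=
  Ideal.span {x : R | x ∈ I ∧ x ∈ (Submodule.span K S) ^ d} = I

/-- The `K`-algebra `R` with set `S` of generators, all of degree `1`, is strongly Koszul: for any
two distinct generators `u` and `v`, the ideal `(u) ∩ (v)` is generated in degree `2`. -/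
def IsStronglyKoszul (K : Type*) [Field K] {R : Type*} [CommRing R] [Algebra K R] (S : Set R) :
    Prop :=
  ∀ u ∈ S, ∀ v ∈ S, u ≠ v → GeneratedInDegree K S 2 (Ideal.span {u} ⊓ Ideal.span {v})

/-- The toric ring `R_G`, with the generators `u_{A|B}`, is strongly Koszul. -/
def ToricRingStronglyKoszul (K : Type*) [Field K] {V : Type*} [Fintype V] (G : SimpleGraph V) :
    Prop :=
  IsStronglyKoszul K (Set.range (cutGen K G))

end CutToric

/-! Since `R_G` has a basis of monomials, strong Koszulness is an exchange property: whenever `u·M =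
v·N` for products of generators with `M ≠ 1`, there are generators `p`, `q` with `u·p = v·q` and `M`
a multiple of `p` in the ring. This is `StronglyKoszulOn`; it depends only on the cut vectors, so
the field plays no further role.

Over `𝔽₂` the cut vectors form a binary code whose coordinates are the edges, and the minimal dual
words supported on edges are the cycles of the graph. Contracting an edge means restricting to the
words that vanish there, which is a face of the semigroup and keeps the exchange property
(`StronglyKoszulOn.face`). Deleting a vertex reduces to deleting its edges. The difficulty is the
deletion of an edge, which is a projection of the semigroup: `codeSK_erase`. It is proved for codes,
with `NoFano` as the only trace of the graph.

Explicit relations without exchange show that a strongly Koszul code has no `K₄` after shortening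
(`not_codeSK_of_completeGraph_four`) and no circuit with five or more elements
(`IsCircuit.card_le_four`). Once zero and repeated coordinates are removed, all circuits have three
or four elements. Let `e` be the coordinate to delete.

If all circuits through `e` are triangles, these split off as a direct summand; without `e` the
summand is the cut code of a `K_{2,I}`, strongly Koszul by `stronglyKoszulOn_twinVec`, and the other
summand is a shortening of the original code. Otherwise `e` lies in a four-element circuit, and the
absence of `K₄` forces another element `f` of it to be in series with `e` (`exists_series`). After
deletion `f` is a coloop, and induction applies to the smaller code obtained by shortening at `f`.
-/

namespace CutToric

/-! ### Strong Koszulness of families of vectors -/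

/-- The multisets `M` and `N` have the same size and, at every coordinate in `J`, the same sum of
the vectors `c x`. -/
def SameSum {κ ι : Type*} (c : κ → ι → ℕ) (J : Set ι) (M N : Multiset κ) : Prop :=
  M.card = N.card ∧ ∀ i ∈ J, (M.map fun x => c x i).sum = (N.map fun x => c x i).sum

/-- The combinatorial form of strong Koszulness of the semigroup ring whose generators are the
vectors `(1, c x)`, `x ∈ P`, with coordinates in `J`. -/
def StronglyKoszulOn {κ ι : Type*} (c : κ → ι → ℕ) (P : Set κ) (J : Set ι) : Prop :=
  ∀ u ∈ P, ∀ v ∈ P, ∀ M N : Multiset κ, (∀ x ∈ M, x ∈ P) → (∀ x ∈ N, x ∈ P) → M ≠ 0 →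
    SameSum c J (u ::ₘ M) (v ::ₘ N) →
    ∃ p ∈ P, ∃ q ∈ P, ∃ L : Multiset κ, (∀ x ∈ L, x ∈ P) ∧
      SameSum c J {u, p} {v, q} ∧ SameSum c J M (p ::ₘ L)

section SameSum

variable {κ κ' ι ι' : Type*} {c : κ → ι → ℕ} {c' : κ' → ι' → ℕ} {J : Set ι} {J' : Set ι'}

theorem SameSum.refl (c : κ → ι → ℕ) (J : Set ι) (M : Multiset κ) : SameSum c J M M :=
  ⟨rfl, fun _ _ => rfl⟩

theorem SameSum.symm {M N : Multiset κ} (h : SameSum c J M N) : SameSum c J N M :=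
  ⟨h.1.symm, fun i hi => (h.2 i hi).symm⟩

theorem SameSum.add {M N M' N' : Multiset κ} (h : SameSum c J M N) (h' : SameSum c J M' N') :
    SameSum c J (M + M') (N + N') := by
  refine ⟨by simp [h.1, h'.1], fun i hi => ?_⟩
  simp [h.2 i hi, h'.2 i hi]

theorem sameSum_pair {u p v q : κ} :
    SameSum c J {u, p} {v, q} ↔ ∀ i ∈ J, c u i + c p i = c v i + c q i := by
  simp [SameSum]

theorem SameSum.of_map {P : Set κ} (f : κ → κ')
    (h : ∀ j ∈ J, (∀ x ∈ P, c x j = 0) ∨ ∃ j' ∈ J', ∀ x ∈ P, c x j = c' (f x) j')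
    {M N : Multiset κ} (hM : ∀ x ∈ M, x ∈ P) (hN : ∀ x ∈ N, x ∈ P)
    (hMN : SameSum c' J' (M.map f) (N.map f)) : SameSum c J M N := by
  refine ⟨by simpa using hMN.1, fun j hj => ?_⟩
  rcases h j hj with h0 | ⟨j', hj', h1⟩
  · rw [Multiset.map_congr rfl (fun x hx => h0 x (hM x hx)),
      Multiset.map_congr rfl (fun x hx => h0 x (hN x hx))]
    simp
  · rw [Multiset.map_congr rfl (fun x hx => h1 x (hM x hx)),
      Multiset.map_congr rfl (fun x hx => h1 x (hN x hx))]
    simpa using hMN.2 j' hj'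

theorem SameSum.map {P : Set κ} (f : κ → κ')
    (h : ∀ j' ∈ J', (∀ x ∈ P, c' (f x) j' = 0) ∨ ∃ j ∈ J, ∀ x ∈ P, c x j = c' (f x) j')
    {M N : Multiset κ} (hM : ∀ x ∈ M, x ∈ P) (hN : ∀ x ∈ N, x ∈ P)
    (hMN : SameSum c J M N) : SameSum c' J' (M.map f) (N.map f) := by
  refine ⟨by simpa using hMN.1, fun j' hj' => ?_⟩
  simp only [Multiset.map_map, Function.comp_def]
  rcases h j' hj' with h0 | ⟨j, hj, h1⟩
  · rw [Multiset.map_congr rfl (fun x hx => h0 x (hM x hx)),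
      Multiset.map_congr rfl (fun x hx => h0 x (hN x hx))]
    simp
  · have := hMN.2 j hj
    rw [Multiset.map_congr rfl (fun x hx => h1 x (hM x hx)),
      Multiset.map_congr rfl (fun x hx => h1 x (hN x hx))] at this
    exact this

theorem exists_map_eq_of_surjOn {P : Set κ} {P' : Set κ'} {f : κ → κ'} (hs : Set.SurjOn f P P')
    (M : Multiset κ') (hM : ∀ x ∈ M, x ∈ P') :
    ∃ N : Multiset κ, (∀ x ∈ N, x ∈ P) ∧ N.map f = M := by
  induction M using Multiset.induction with
  | empty => exact ⟨0, by simp, by simp⟩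
  | cons a M ih =>
    obtain ⟨N, hN, rfl⟩ := ih fun x hx => hM x (Multiset.mem_cons_of_mem hx)
    obtain ⟨b, hb, rfl⟩ := hs (hM a (Multiset.mem_cons_self a _))
    refine ⟨b ::ₘ N, ?_, by simp⟩
    intro x hx
    rcases Multiset.mem_cons.1 hx with rfl | hx
    exacts [hb, hN x hx]

theorem mem_of_mem_cons {P : Set κ} {u : κ} {M : Multiset κ} (hu : u ∈ P) (hM : ∀ x ∈ M, x ∈ P) :
    ∀ x ∈ u ::ₘ M, x ∈ P := by
  intro x hx
  rcases Multiset.mem_cons.1 hx with rfl | hx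
  exacts [hu, hM x hx]

theorem mem_of_mem_pair {P : Set κ} {u v : κ} (hu : u ∈ P) (hv : v ∈ P) :
    ∀ x ∈ ({u, v} : Multiset κ), x ∈ P := by
  intro x hx
  simp only [Multiset.insert_eq_cons, Multiset.mem_cons, Multiset.mem_singleton] at hx
  rcases hx with rfl | rfl
  exacts [hu, hv]

/-- Zero coordinates impose no condition and repeated coordinates impose the same one twice, so both
families satisfy the same relations, and surjectivity of `f` lifts the witnesses. All changes of
model (graphs to codes, loops, parallel edges, isomorphisms) pass through this. -/
theorem stronglyKoszulOn_transfer {P : Set κ} {P' : Set κ'} (f : κ → κ') (hf : Set.MapsTo f P P')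
    (hs : Set.SurjOn f P P')
    (h : ∀ j ∈ J, (∀ x ∈ P, c x j = 0) ∨ ∃ j' ∈ J', ∀ x ∈ P, c x j = c' (f x) j')
    (h' : ∀ j' ∈ J', (∀ x ∈ P, c' (f x) j' = 0) ∨ ∃ j ∈ J, ∀ x ∈ P, c x j = c' (f x) j') :
    StronglyKoszulOn c P J ↔ StronglyKoszulOn c' P' J' := by
  have key : ∀ M N : Multiset κ, (∀ x ∈ M, x ∈ P) → (∀ x ∈ N, x ∈ P) →
      (SameSum c J M N ↔ SameSum c' J' (M.map f) (N.map f)) := fun M N hM hN =>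
    ⟨SameSum.map f h' hM hN, SameSum.of_map f h hM hN⟩
  constructor
  · intro H u' hu' v' hv' M' N' hM' hN' h0 hS
    obtain ⟨u, hu, rfl⟩ := hs hu'
    obtain ⟨v, hv, rfl⟩ := hs hv'
    obtain ⟨M, hM, rfl⟩ := exists_map_eq_of_surjOn hs M' hM'
    obtain ⟨N, hN, rfl⟩ := exists_map_eq_of_surjOn hs N' hN'
    rw [← Multiset.map_cons, ← Multiset.map_cons,
      ← key _ _ (mem_of_mem_cons hu hM) (mem_of_mem_cons hv hN)] at hS
    obtain ⟨p, hp, q, hq, L, hL, h1, h2⟩ := H u hu v hv M N hM hN (by rintro rfl; simp at h0) hS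
    refine ⟨f p, hf hp, f q, hf hq, L.map f, ?_, ?_, ?_⟩
    · intro x hx
      obtain ⟨y, hy, rfl⟩ := Multiset.mem_map.1 hx
      exact hf (hL y hy)
    · rw [key _ _ (mem_of_mem_pair hu hp) (mem_of_mem_pair hv hq)] at h1
      simpa using h1
    · rw [key _ _ hM (mem_of_mem_cons hp hL)] at h2
      simpa using h2
  · intro H u hu v hv M N hM hN h0 hS
    rw [key _ _ (mem_of_mem_cons hu hM) (mem_of_mem_cons hv hN), Multiset.map_cons,
      Multiset.map_cons] at hS
    have hmap : ∀ M : Multiset κ, (∀ x ∈ M, x ∈ P) → ∀ x ∈ M.map f, x ∈ P' := by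
      intro M hM x hx
      obtain ⟨y, hy, rfl⟩ := Multiset.mem_map.1 hx
      exact hf (hM y hy)
    obtain ⟨p', hp', q', hq', L', hL', h1, h2⟩ := H _ (hf hu) _ (hf hv) _ _ (hmap M hM) (hmap N hN)
      (by simpa using h0) hS
    obtain ⟨p, hp, rfl⟩ := hs hp'
    obtain ⟨q, hq, rfl⟩ := hs hq'
    obtain ⟨L, hL, rfl⟩ := exists_map_eq_of_surjOn hs L' hL'
    refine ⟨p, hp, q, hq, L, hL, ?_, ?_⟩
    · rw [key _ _ (mem_of_mem_pair hu hp) (mem_of_mem_pair hv hq)]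
      simpa using h1
    · rw [key _ _ hM (mem_of_mem_cons hp hL)]
      simpa using h2

/-- Changing the set of coordinates, up to zero coordinates and repeated coordinates. -/
theorem stronglyKoszulOn_congr_coords {P : Set κ} {I : Set ι}
    (h : ∀ j ∈ J, (∀ x ∈ P, c x j = 0) ∨ ∃ i ∈ I, ∀ x ∈ P, c x j = c x i)
    (h' : ∀ i ∈ I, (∀ x ∈ P, c x i = 0) ∨ ∃ j ∈ J, ∀ x ∈ P, c x j = c x i) :
    StronglyKoszulOn c P J ↔ StronglyKoszulOn c P I :=
  stronglyKoszulOn_transfer id (Set.mapsTo_id P) (Set.surjOn_id P) h h'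

/-- `v·N = u·M = u·p·L = v·q·L`, and `v` cancels. Hence an exchange found from one side of a
relation serves the other side too. -/
theorem SameSum.cancel_left {u v q : κ} {p : κ} {M N L : Multiset κ}
    (h : SameSum c J (u ::ₘ M) (v ::ₘ N)) (h1 : SameSum c J {u, p} {v, q})
    (h2 : SameSum c J M (p ::ₘ L)) : SameSum c J N (q ::ₘ L) := by
  refine ⟨?_, fun i hi => ?_⟩
  · have := h.1
    have := h2.1
    simp at *
    omega
  · have a := h.2 i hi
    have b := h1.2 i hi
    have d := h2.2 i hi
    simp at *
    omega

/-- Passing to the generators that vanish on a set of coordinates. -/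
theorem StronglyKoszulOn.face {P : Set κ} (h : StronglyKoszulOn c P J) {F : Set ι} (hF : F ⊆ J) :
    StronglyKoszulOn c {x | x ∈ P ∧ ∀ i ∈ F, c x i = 0} J := by
  rintro u ⟨hu, hu0⟩ v ⟨hv, hv0⟩ M N hM hN h0 hS
  obtain ⟨p, hp, q, hq, L, hL, h1, h2⟩ := h u hu v hv M N (fun x hx => (hM x hx).1)
    (fun x hx => (hN x hx).1) h0 hS
  -- Coordinates are nonnegative, so a sum that vanishes on `F` forces every summand to vanish
  -- there.
  have hz : ∀ i ∈ F, ∀ x ∈ p ::ₘ L, c x i = 0 := by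
    intro i hi x hx
    have := h2.2 i (hF hi)
    rw [Multiset.map_congr rfl (fun x hx => (hM x hx).2 i hi)] at this
    simp only [Multiset.map_const', Multiset.sum_replicate, smul_zero] at this
    exact Multiset.sum_eq_zero_iff.1 this.symm _ (Multiset.mem_map_of_mem _ hx)
  refine ⟨p, ⟨hp, fun i hi => hz i hi p (Multiset.mem_cons_self _ _)⟩, q, ⟨hq, fun i hi => ?_⟩, L,
    fun x hx => ⟨hL x hx, fun i hi => hz i hi x (Multiset.mem_cons_of_mem hx)⟩, h1, h2⟩
  have := sameSum_pair.1 h1 i (hF hi)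
  rw [hu0 i hi, hv0 i hi, hz i hi p (Multiset.mem_cons_self _ _)] at this
  omega

end SameSum

/-! ### Binary codes -/

section Code

variable {ι : Type*}

/-- The integer coordinates of a binary vector. -/
def bits (x : ι → ZMod 2) (i : ι) : ℕ := (x i).val

theorem bits_eq_zero {x : ι → ZMod 2} {i : ι} : bits x i = 0 ↔ x i = 0 := by
  simp [bits]

theorem zmod_two_eq (a : ZMod 2) : a = 0 ∨ a = 1 := by
  revert a; decide

theorem bits_le_one (x : ι → ZMod 2) (i : ι) : bits x i ≤ 1 := by
  have := ZMod.val_lt (x i)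
  simp only [bits]; omega

/-- The binary code `C` with coordinates in `J` has a strongly Koszul semigroup ring. -/
abbrev CodeSK (C : Submodule (ZMod 2) (ι → ZMod 2)) (J : Set ι) : Prop :=
  StronglyKoszulOn bits (C : Set (ι → ZMod 2)) J

/-- The words of `C` that vanish on `F`. -/
def shorten (F : Set ι) (C : Submodule (ZMod 2) (ι → ZMod 2)) :
    Submodule (ZMod 2) (ι → ZMod 2) where
  carrier := {x | x ∈ C ∧ ∀ i ∈ F, x i = 0}
  add_mem' := by
    rintro x y ⟨hx, hx0⟩ ⟨hy, hy0⟩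
    exact ⟨C.add_mem hx hy, fun i hi => by simp [hx0 i hi, hy0 i hi]⟩
  zero_mem' := ⟨C.zero_mem, fun _ _ => rfl⟩
  smul_mem' := by
    rintro a x ⟨hx, hx0⟩
    exact ⟨C.smul_mem a hx, fun i hi => by simp [hx0 i hi]⟩

theorem mem_shorten {F : Set ι} {C : Submodule (ZMod 2) (ι → ZMod 2)} {x : ι → ZMod 2} :
    x ∈ shorten F C ↔ x ∈ C ∧ ∀ i ∈ F, x i = 0 := Iff.rfl

theorem shorten_le (F : Set ι) (C : Submodule (ZMod 2) (ι → ZMod 2)) : shorten F C ≤ C :=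
  fun _ hx => hx.1

theorem shorten_shorten (F F' : Set ι) (C : Submodule (ZMod 2) (ι → ZMod 2)) :
    shorten F (shorten F' C) = shorten (F ∪ F') C := by
  ext x
  simp only [mem_shorten, Set.mem_union]
  constructor
  · rintro ⟨⟨h1, h2⟩, h3⟩
    exact ⟨h1, fun i hi => hi.elim (h3 i) (h2 i)⟩
  · rintro ⟨h1, h2⟩
    exact ⟨⟨h1, fun i hi => h2 i (Or.inr hi)⟩, fun i hi => h2 i (Or.inl hi)⟩

theorem codeSK_shorten {C : Submodule (ZMod 2) (ι → ZMod 2)} {J F : Set ι} (h : CodeSK C J)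
    (hF : F ⊆ J) : CodeSK (shorten F C) J := by
  have := h.face hF
  simp only [bits_eq_zero] at this
  exact this

theorem codeSK_congr_coords {C : Submodule (ZMod 2) (ι → ZMod 2)} {I J : Set ι}
    (h : ∀ j ∈ J, (∀ x ∈ C, x j = 0) ∨ ∃ i ∈ I, ∀ x ∈ C, x j = x i)
    (h' : ∀ i ∈ I, (∀ x ∈ C, x i = 0) ∨ ∃ j ∈ J, ∀ x ∈ C, x j = x i) :
    CodeSK C J ↔ CodeSK C I := by
  refine stronglyKoszulOn_congr_coords (fun j hj => ?_) (fun i hi => ?_)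
  · refine (h j hj).imp (fun h x hx => bits_eq_zero.2 (h x hx)) ?_
    rintro ⟨i, hi, h⟩
    exact ⟨i, hi, fun x hx => by simp [bits, h x hx]⟩
  · refine (h' i hi).imp (fun h x hx => bits_eq_zero.2 (h x hx)) ?_
    rintro ⟨i, hi, h⟩
    exact ⟨i, hi, fun x hx => by simp [bits, h x hx]⟩

/-- The elements are added in pairs; on `J` the supports are disjoint, so each sum shows one summand
on `T` and the other off `T`. -/
theorem exists_multiset_add {P Q : Set (ι → ZMod 2)} {C : Submodule (ZMod 2) (ι → ZMod 2)}
    {J T : Set ι} (hP : ∀ x ∈ P, x ∈ C ∧ ∀ i ∈ J \ T, x i = 0)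
    (hQ : ∀ x ∈ Q, x ∈ C ∧ ∀ i ∈ J ∩ T, x i = 0) (L₁ L₂ : Multiset (ι → ZMod 2))
    (h₁ : ∀ x ∈ L₁, x ∈ P) (h₂ : ∀ x ∈ L₂, x ∈ Q) (hc : L₁.card = L₂.card) :
    ∃ L : Multiset (ι → ZMod 2), (∀ x ∈ L, x ∈ C) ∧ L.card = L₁.card ∧
      (∀ i ∈ J ∩ T, (L.map fun x => bits x i) = L₁.map fun x => bits x i) ∧
      (∀ i ∈ J \ T, (L.map fun x => bits x i) = L₂.map fun x => bits x i) := by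
  induction L₁ using Multiset.induction generalizing L₂ with
  | empty =>
    have : L₂ = 0 := by simpa using hc.symm
    exact ⟨0, by simp, by simp, by simp, by simp [this]⟩
  | cons a L₁ ih =>
    obtain ⟨b, hb⟩ : ∃ b, b ∈ L₂ := by
      refine Multiset.exists_mem_of_ne_zero ?_
      rintro rfl
      simp at hc
    obtain ⟨L₂, rfl⟩ := Multiset.exists_cons_of_mem hb
    obtain ⟨L, hL, hcard, hL1, hL2⟩ := ih L₂ (fun x hx => h₁ x (Multiset.mem_cons_of_mem hx))
      (fun x hx => h₂ x (Multiset.mem_cons_of_mem hx)) (by simpa using hc)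
    have ha := hP a (h₁ a (Multiset.mem_cons_self _ _))
    have hb := hQ b (h₂ b (Multiset.mem_cons_self _ _))
    refine ⟨(a + b) ::ₘ L, ?_, by simp [hcard], fun i hi => ?_, fun i hi => ?_⟩
    · exact mem_of_mem_cons (P := (C : Set (ι → ZMod 2))) (C.add_mem ha.1 hb.1) hL
    · rw [Multiset.map_cons, Multiset.map_cons, hL1 i hi]; simp [bits, hb.2 i hi]
    · rw [Multiset.map_cons, Multiset.map_cons, hL2 i hi]; simp [bits, ha.2 i hi]

/-- A code that splits as a direct sum of two codes with disjoint supports is strongly Koszul if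
both summands are. -/
theorem codeSK_of_directSum {C : Submodule (ZMod 2) (ι → ZMod 2)} {J : Set ι} (T : Set ι)
    (hT : ∀ x ∈ C, ∃ y ∈ C, (∀ i ∈ J ∩ T, y i = x i) ∧ ∀ i ∈ J \ T, y i = 0)
    (h₁ : CodeSK (shorten (J \ T) C) J) (h₂ : CodeSK (shorten (J ∩ T) C) J) :
    CodeSK C J := by
  classical
  -- `f` projects to the part in `T`; in characteristic two, `x + f x` is the complementary
  -- projection.
  choose! f hfC hfT hfT' using hT
  have hf1 : ∀ x ∈ C, f x ∈ shorten (J \ T) C := fun x hx => ⟨hfC x hx, hfT' x hx⟩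
  have hg1 : ∀ x ∈ C, x + f x ∈ shorten (J ∩ T) C := fun x hx =>
    ⟨C.add_mem hx (hfC x hx), fun i hi => by
      rw [Pi.add_apply, hfT x hx i hi]; exact CharTwo.add_self_eq_zero _⟩
  have hgT : ∀ x ∈ C, ∀ i ∈ J \ T, (x + f x) i = x i := fun x hx i hi => by
    simp [hfT' x hx i hi]
  intro u hu v hv M N hM hN h0 hS
  have mapF : ∀ M : Multiset (ι → ZMod 2), (∀ x ∈ M, x ∈ C) →
      (∀ x ∈ M.map f, x ∈ shorten (J \ T) C) := by
    intro M hM x hx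
    obtain ⟨y, hy, rfl⟩ := Multiset.mem_map.1 hx
    exact hf1 y (hM y hy)
  have mapG : ∀ M : Multiset (ι → ZMod 2), (∀ x ∈ M, x ∈ C) →
      (∀ x ∈ M.map fun x => x + f x, x ∈ shorten (J ∩ T) C) := by
    intro M hM x hx
    obtain ⟨y, hy, rfl⟩ := Multiset.mem_map.1 hx
    exact hg1 y (hM y hy)
  have sumF : ∀ M : Multiset (ι → ZMod 2), (∀ x ∈ M, x ∈ C) → ∀ i ∈ J ∩ T,
      ((M.map f).map fun x => bits x i) = M.map fun x => bits x i := by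
    intro M hM i hi
    rw [Multiset.map_map]
    exact Multiset.map_congr rfl fun x hx => by simp only [Function.comp, bits, hfT x (hM x hx) i hi]
  have sumF' : ∀ M : Multiset (ι → ZMod 2), (∀ x ∈ M, x ∈ C) → ∀ i ∈ J \ T,
      (((M.map f).map fun x => bits x i).sum) = 0 := by
    intro M hM i hi
    rw [Multiset.map_map, Multiset.map_congr rfl (g := fun _ => 0) fun x hx => by
      simp only [Function.comp, bits_eq_zero, hfT' x (hM x hx) i hi]]
    simp
  have sumG : ∀ M : Multiset (ι → ZMod 2), (∀ x ∈ M, x ∈ C) → ∀ i ∈ J \ T,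
      ((M.map fun x => x + f x).map fun x => bits x i) = M.map fun x => bits x i := by
    intro M hM i hi
    rw [Multiset.map_map]
    exact Multiset.map_congr rfl fun x hx => by simp only [Function.comp, bits, hgT x (hM x hx) i hi]
  have sumG' : ∀ M : Multiset (ι → ZMod 2), (∀ x ∈ M, x ∈ C) → ∀ i ∈ J ∩ T,
      (((M.map fun x => x + f x).map fun x => bits x i).sum) = 0 := by
    intro M hM i hi
    rw [Multiset.map_map, Multiset.map_congr rfl (g := fun _ => 0) fun x hx => by
      simp only [Function.comp, bits_eq_zero, (hg1 x (hM x hx)).2 i hi]]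
    simp
  have hMu := mem_of_mem_cons (P := (C : Set (ι → ZMod 2))) hu hM
  have hNv := mem_of_mem_cons (P := (C : Set (ι → ZMod 2))) hv hN
  have hS1 : SameSum bits J ((u ::ₘ M).map f) ((v ::ₘ N).map f) := by
    refine ⟨by simpa using hS.1, fun i hi => ?_⟩
    by_cases hiT : i ∈ T
    · rw [sumF _ hMu i ⟨hi, hiT⟩, sumF _ hNv i ⟨hi, hiT⟩]
      exact hS.2 i hi
    · rw [sumF' _ hMu i ⟨hi, hiT⟩, sumF' _ hNv i ⟨hi, hiT⟩]
  have hS2 : SameSum bits J ((u ::ₘ M).map fun x => x + f x) ((v ::ₘ N).map fun x => x + f x) := by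
    refine ⟨by simpa using hS.1, fun i hi => ?_⟩
    by_cases hiT : i ∈ T
    · rw [sumG' _ hMu i ⟨hi, hiT⟩, sumG' _ hNv i ⟨hi, hiT⟩]
    · rw [sumG _ hMu i ⟨hi, hiT⟩, sumG _ hNv i ⟨hi, hiT⟩]
      exact hS.2 i hi
  rw [Multiset.map_cons, Multiset.map_cons] at hS1 hS2
  obtain ⟨p₁, hp₁, q₁, hq₁, L₁, hL₁, h11, h12⟩ := h₁ _ (hf1 u hu) _ (hf1 v hv) _ _ (mapF M hM)
    (mapF N hN) (by simpa using h0) hS1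
  obtain ⟨p₂, hp₂, q₂, hq₂, L₂, hL₂, h21, h22⟩ := h₂ _ (hg1 u hu) _ (hg1 v hv) _ _ (mapG M hM)
    (mapG N hN) (by simpa using h0) hS2
  have hc : L₁.card = L₂.card := by
    have := h12.1
    have := h22.1
    simp at *
    omega
  obtain ⟨L, hL, hLc, hLT, hLT'⟩ := exists_multiset_add (P := shorten (J \ T) C)
    (Q := shorten (J ∩ T) C) (C := C) (J := J) (T := T) (fun x hx => hx) (fun x hx => hx)
    L₁ L₂ hL₁ hL₂ hc
  refine ⟨p₁ + p₂, C.add_mem hp₁.1 hp₂.1, q₁ + q₂, C.add_mem hq₁.1 hq₂.1, L, hL, ?_, ?_⟩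
  · rw [sameSum_pair] at h11 h21 ⊢
    intro i hi
    by_cases hiT : i ∈ T
    · have := h11 i hi
      simpa [bits, hp₂.2 i ⟨hi, hiT⟩, hq₂.2 i ⟨hi, hiT⟩, hfT u hu i ⟨hi, hiT⟩,
        hfT v hv i ⟨hi, hiT⟩] using this
    · have := h21 i hi
      simpa [bits, hp₁.2 i ⟨hi, hiT⟩, hq₁.2 i ⟨hi, hiT⟩, hfT' u hu i ⟨hi, hiT⟩,
        hfT' v hv i ⟨hi, hiT⟩] using this
  · refine ⟨by simpa [hLc] using h12.1, fun i hi => ?_⟩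
    by_cases hiT : i ∈ T
    · have := h12.2 i hi
      rw [sumF M hM i ⟨hi, hiT⟩] at this
      rw [this, Multiset.map_cons, Multiset.map_cons, hLT i ⟨hi, hiT⟩]
      simp [bits, hp₂.2 i ⟨hi, hiT⟩]
    · have := h22.2 i hi
      rw [sumG M hM i ⟨hi, hiT⟩] at this
      rw [this, Multiset.map_cons, Multiset.map_cons, hLT' i ⟨hi, hiT⟩]
      simp [bits, hp₁.2 i ⟨hi, hiT⟩]

/-- A code with one coordinate is strongly Koszul. -/
theorem codeSK_of_single {C : Submodule (ZMod 2) (ι → ZMod 2)} {J : Set ι} (f : ι)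
    (h : ∀ x ∈ C, ∀ i ∈ J \ {f}, x i = 0) : CodeSK C J := by
  classical
  suffices CodeSK C {f} by
    by_cases hf : f ∈ J
    · refine (codeSK_congr_coords (fun j hj => ?_) (fun i hi => ?_)).2 this
      · by_cases hj' : j = f
        · exact Or.inr ⟨f, rfl, fun x _ => by rw [hj']⟩
        · exact Or.inl fun x hx => h x hx j ⟨hj, hj'⟩
      · rw [Set.mem_singleton_iff] at hi
        subst hi
        exact Or.inr ⟨i, hf, fun _ _ => rfl⟩
    · refine (codeSK_congr_coords (I := ∅) (fun j hj => ?_) (fun i hi => hi.elim)).2 ?_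
      · exact Or.inl fun x hx => h x hx j ⟨hj, fun h => hf (h ▸ hj)⟩
      · intro u hu v hv M N hM hN h0 hS
        obtain ⟨p, hp⟩ := Multiset.exists_mem_of_ne_zero h0
        obtain ⟨L, rfl⟩ := Multiset.exists_cons_of_mem hp
        exact ⟨p, hM p hp, p, hM p hp, L, fun x hx => hM x (Multiset.mem_cons_of_mem hx),
          ⟨by simp, fun i hi => hi.elim⟩, SameSum.refl _ _ _⟩
  intro u hu v hv M N hM hN h0 hS
  by_cases huv : u f = v f
  · obtain ⟨p, hp⟩ := Multiset.exists_mem_of_ne_zero h0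
    obtain ⟨L, rfl⟩ := Multiset.exists_cons_of_mem hp
    exact ⟨p, hM p hp, p, hM p hp, L, fun x hx => hM x (Multiset.mem_cons_of_mem hx),
      sameSum_pair.2 (by simp [bits, huv]), SameSum.refl _ _ _⟩
  by_cases hex : ∃ p ∈ M, p f = v f
  · obtain ⟨p, hp, hpv⟩ := hex
    obtain ⟨L, rfl⟩ := Multiset.exists_cons_of_mem hp
    exact ⟨p, hM p hp, u, hu, L, fun x hx => hM x (Multiset.mem_cons_of_mem hx),
      sameSum_pair.2 (by simp [bits, hpv, add_comm]), SameSum.refl _ _ _⟩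
  -- Here `u` and all members of `M` share one value at `f`, so the left sum is the least or the
  -- greatest possible; `v` on the right prevents equality.
  · exfalso
    push Not at hex
    have hMu : ∀ p ∈ M, bits p f = bits u f := by
      intro p hp
      have := hex p hp
      simp only [bits]
      congr 1
      rcases zmod_two_eq (p f) with h1 | h1 <;> rcases zmod_two_eq (v f) with h2 | h2 <;>
        rcases zmod_two_eq (u f) with h3 | h3 <;> simp_all
    have h1 := hS.2 f rfl
    have h2 := hS.1
    have hN1 : (N.map fun x => bits x f).sum ≤ N.card := by
      have := Multiset.sum_le_card_nsmul (N.map fun x => bits x f) 1 (by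
        intro x hx
        obtain ⟨y, _, rfl⟩ := Multiset.mem_map.1 hx
        exact bits_le_one y f)
      simpa using this
    simp only [Multiset.map_cons, Multiset.sum_cons, Multiset.card_cons] at h1 h2
    rw [Multiset.map_congr rfl hMu] at h1
    simp only [Multiset.map_const', Multiset.sum_replicate, smul_eq_mul] at h1
    rcases zmod_two_eq (v f) with h3 | h3 <;> rcases zmod_two_eq (u f) with h4 | h4 <;>
      simp only [bits, h3, h4, ZMod.val_zero, ZMod.val_one] at h1 huv hN1 <;> first | omega | simp at huv

end Code

/-! ### Dual words, shortening onto a set, and the `K₄` obstruction -/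

section Words

variable {ι : Type*} {C : Submodule (ZMod 2) (ι → ZMod 2)} {J : Set ι}

/-- The set of coordinates `w` is a word of the dual code of `C`. -/
def IsWord (C : Submodule (ZMod 2) (ι → ZMod 2)) (w : Finset ι) : Prop :=
  ∀ x ∈ C, ∑ i ∈ w, x i = 0

/-- A minimal nonempty word of the dual code. -/
def IsCircuit (C : Submodule (ZMod 2) (ι → ZMod 2)) (w : Finset ι) : Prop :=
  IsWord C w ∧ w.Nonempty ∧ ∀ w' ⊆ w, IsWord C w' → w' = ∅ ∨ w' = w

theorem isWord_empty (C : Submodule (ZMod 2) (ι → ZMod 2)) : IsWord C ∅ := by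
  simp [IsWord]

theorem sum_symmDiff_zmod_two [DecidableEq ι] (x : ι → ZMod 2) (w w' : Finset ι) :
    ∑ i ∈ symmDiff w w', x i = ∑ i ∈ w, x i + ∑ i ∈ w', x i := by
  rw [symmDiff_def, Finset.sup_eq_union, Finset.sum_union disjoint_sdiff_sdiff,
    ← Finset.sum_inter_add_sum_sdiff w w' x, ← Finset.sum_inter_add_sum_sdiff w' w x,
    Finset.inter_comm w' w]
  generalize ∑ i ∈ w ∩ w', x i = a
  generalize ∑ i ∈ w \ w', x i = b
  generalize ∑ i ∈ w' \ w, x i = c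
  revert a b c
  decide

theorem IsWord.symmDiff [DecidableEq ι] {w w' : Finset ι} (h : IsWord C w) (h' : IsWord C w') :
    IsWord C (symmDiff w w') := fun x hx => by
  rw [sum_symmDiff_zmod_two, h x hx, h' x hx, add_zero]

/-- A family of coordinates of a code takes all values permitted by the dual code. -/
theorem exists_mem_eq_of_dual {α : Type*} [Finite α] (C : Submodule (ZMod 2) (ι → ZMod 2))
    (h : α → ι) (t : α → ZMod 2)
    (H : ∀ s : Finset α, (∀ x ∈ C, ∑ i ∈ s, x (h i) = 0) → ∑ i ∈ s, t i = 0) :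
    ∃ x ∈ C, ∀ i, x (h i) = t i := by
  classical
  have := Fintype.ofFinite α
  by_contra hcon
  have ht : t ∉ C.map (LinearMap.funLeft (ZMod 2) (ZMod 2) h) := by
    rintro ⟨x, hx, rfl⟩
    exact hcon ⟨x, hx, fun i => rfl⟩
  -- A functional over `𝔽₂` that separates `t` from the image of `C` is a sum over a subset, and
  -- that subset contradicts `H`.
  obtain ⟨f, hf, hC⟩ := Submodule.exists_le_ker_of_notMem ht
  have hsum : ∀ z : α → ZMod 2,
      f z = ∑ i ∈ Finset.univ.filter (fun i => f (Pi.single i 1) ≠ 0), z i := by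
    intro z
    rw [LinearMap.pi_apply_eq_sum_univ f z, Finset.sum_filter]
    refine Finset.sum_congr rfl fun i _ => ?_
    have : (fun j => if i = j then (1 : ZMod 2) else 0) = Pi.single i 1 := by
      ext j
      simp [Pi.single_apply, eq_comm]
    rw [this]
    rcases zmod_two_eq (f (Pi.single i 1)) with h0 | h0 <;> simp [h0]
  apply hf
  rw [hsum]
  apply H
  intro x hx
  have := hC (Submodule.mem_map_of_mem hx)
  rw [LinearMap.mem_ker, hsum] at this
  exact this

/-- A vector agrees with a word of the code on a finite set `S` if it is orthogonal to all dual
words inside `S`. -/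
theorem exists_mem_eqOn_of_dual (C : Submodule (ZMod 2) (ι → ZMod 2)) (S : Finset ι)
    (t : ι → ZMod 2) (H : ∀ w ⊆ S, IsWord C w → ∑ i ∈ w, t i = 0) :
    ∃ x ∈ C, ∀ i ∈ S, x i = t i := by
  obtain ⟨x, hx, hxt⟩ := exists_mem_eq_of_dual C (fun i : S => (i : ι)) (fun i => t i) (by
    intro s hs
    have := H (s.map (Function.Embedding.subtype _)) (by
      intro i hi
      obtain ⟨j, _, rfl⟩ := Finset.mem_map.1 hi
      exact j.2) (fun x hx => by simpa using hs x hx)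
    simpa using this)
  exact ⟨x, hx, fun i hi => hxt ⟨i, hi⟩⟩

/-- After shortening, a code becomes determined by its coordinates in `D`, with the same
restriction to `D`. -/
theorem exists_shorten_injOn (C : Submodule (ZMod 2) (ι → ZMod 2)) (D : Set ι) (hJ : J.Finite) :
    ∃ F ⊆ J, (∀ x ∈ C, ∃ y ∈ shorten F C, ∀ i ∈ D, y i = x i) ∧
      ∀ x ∈ shorten F C, (∀ i ∈ D, x i = 0) → ∀ i ∈ J, x i = 0 := by
  induction J, hJ using Set.Finite.induction_on with
  | empty =>
    exact ⟨∅, subset_rfl, fun x hx => ⟨x, ⟨hx, by simp⟩, fun _ _ => rfl⟩, by simp⟩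
  | @insert j J _ _ ih =>
    obtain ⟨F, hFJ, hF1, hF2⟩ := ih
    -- A word that vanishes on `D` but not at `j` corrects any word to vanish at `j` without
    -- changing it on `D`, so `j` may join `F`. If there is none, `j` is already determined by `D`.
    by_cases hex : ∃ x ∈ shorten F C, (∀ i ∈ D, x i = 0) ∧ x j = 1
    · obtain ⟨z, hz, hzD, hzj⟩ := hex
      refine ⟨insert j F, Set.insert_subset_insert hFJ, fun x hx => ?_, fun x hx hxD i hi => ?_⟩
      · obtain ⟨y, hy, hyD⟩ := hF1 x hx
        rcases zmod_two_eq (y j) with h0 | h0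
        · exact ⟨y, ⟨hy.1, by rintro i (rfl | hi); exacts [h0, hy.2 i hi]⟩, hyD⟩
        · refine ⟨y + z, ⟨C.add_mem hy.1 hz.1, ?_⟩, fun i hi => by simp [hyD i hi, hzD i hi]⟩
          rintro i (rfl | hi)
          · rw [Pi.add_apply, h0, hzj]; rfl
          · simp [hy.2 i hi, hz.2 i hi]
      · rcases hi with rfl | hi
        · exact hx.2 _ (Set.mem_insert _ _)
        · exact hF2 x ⟨hx.1, fun i hi => hx.2 i (Set.mem_insert_of_mem _ hi)⟩ hxD i hi
    · refine ⟨F, hFJ.trans (Set.subset_insert _ _), hF1, fun x hx hxD i hi => ?_⟩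
      rcases hi with rfl | hi
      · exact (zmod_two_eq _).resolve_right fun h => hex ⟨x, hx, hxD, h⟩
      · exact hF2 x hx hxD i hi

/-- No shortening of `C` has all seven nonzero functionals of a three-dimensional quotient among
its coordinates. -/
def NoFano (C : Submodule (ZMod 2) (ι → ZMod 2)) : Prop :=
  ∀ (F : Set ι) (e a b ea eb ab eab : ι),
    (∀ x ∈ shorten F C, x ea = x e + x a ∧ x eb = x e + x b ∧ x ab = x a + x b ∧
      x eab = x e + x a + x b) →
    (∃ y ∈ shorten F C, y e = 1 ∧ y a = 0 ∧ y b = 0) →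
    (∃ y ∈ shorten F C, y e = 0 ∧ y a = 1 ∧ y b = 0) →
    (∃ y ∈ shorten F C, y e = 0 ∧ y a = 0 ∧ y b = 1) → False

theorem NoFano.shorten (h : NoFano C) (F : Set ι) : NoFano (shorten F C) := by
  intro F'
  rw [shorten_shorten]
  exact h _

/-- The six coordinates are the nonzero functionals on a three-dimensional space except `a + b`,
that is, `K₄`. After shortening until `e`, `a`, `b` determine a word, `NoFano` excludes `a + b`. The
relation compares the four words with `a + b = 0` to the four with `a + b = 1`: any other nonzero
functional takes the value one exactly twice on each side. -/
theorem not_codeSK_of_completeGraph_four (hJ : J.Finite) (hC : CodeSK C J) (hN : NoFano C)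
    {e a b c p q : ι} (heJ : e ∈ J) (haJ : a ∈ J) (hbJ : b ∈ J) (hcJ : c ∈ J) (hpJ : p ∈ J)
    (hqJ : q ∈ J) (hc : ∀ x ∈ C, x c = x e + x a + x b) (hp : ∀ x ∈ C, x p = x e + x a)
    (hq : ∀ x ∈ C, x q = x e + x b)
    (h₁ : ∃ y ∈ C, y e = 1 ∧ y a = 0 ∧ y b = 0) (h₂ : ∃ y ∈ C, y e = 0 ∧ y a = 1 ∧ y b = 0)
    (h₃ : ∃ y ∈ C, y e = 0 ∧ y a = 0 ∧ y b = 1) : False := by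
  obtain ⟨F, hFJ, hF1, hF2⟩ := exists_shorten_injOn C {e, a, b} hJ
  have lift : ∀ {α β γ : ZMod 2}, (∃ y ∈ C, y e = α ∧ y a = β ∧ y b = γ) →
      ∃ y ∈ CutToric.shorten F C, y e = α ∧ y a = β ∧ y b = γ := by
    rintro α β γ ⟨y, hy, rfl, rfl, rfl⟩
    obtain ⟨z, hz, hzD⟩ := hF1 y hy
    exact ⟨z, hz, hzD e (by simp), hzD a (by simp), hzD b (by simp)⟩
  have h₁' := lift h₁
  have h₂' := lift h₂
  have h₃' := lift h₃
  obtain ⟨y₁, hy₁, e1, a1, b1⟩ := lift h₁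
  obtain ⟨y₂, hy₂, e2, a2, b2⟩ := lift h₂
  obtain ⟨y₃, hy₃, e3, a3, b3⟩ := lift h₃
  set C₁ := CutToric.shorten F C with hC₁
  have hsub : ∀ x ∈ C₁, x ∈ C := shorten_le F C
  have hno : ∀ k ∈ J, ¬ (y₁ k = 0 ∧ y₂ k = 1 ∧ y₃ k = 1) := by
    rintro k hk ⟨k1, k2, k3⟩
    refine hN F e a b p q k c (fun x hx => ⟨hp x (hsub x hx), hq x (hsub x hx), ?_,
      hc x (hsub x hx)⟩) h₁' h₂' h₃'
    have hz := hF2 (x + x e • y₁ + x a • y₂ + x b • y₃)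
      (add_mem (add_mem (add_mem hx (C₁.smul_mem _ hy₁)) (C₁.smul_mem _ hy₂))
        (C₁.smul_mem _ hy₃)) (by
        simp [e1, e2, e3, a1, a2, a3, b1, b2, b3, CharTwo.add_self_eq_zero]) k hk
    simp only [Pi.add_apply, Pi.smul_apply, smul_eq_mul, k1, k2, k3] at hz
    generalize x k = s at hz ⊢
    generalize x a = s' at hz ⊢
    generalize x b = s'' at hz ⊢
    generalize x e = s''' at hz
    revert hz s s' s'' s'''
    decide
  have hSK : CodeSK C₁ J := codeSK_shorten hC hFJ
  have mem2 : ∀ {x y : ι → ZMod 2}, x ∈ C₁ → y ∈ C₁ → x + y ∈ C₁ := C₁.add_mem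
  obtain ⟨r, hr, s, hs, L, hL, hpair, hML⟩ := hSK 0 C₁.zero_mem y₂ hy₂ {y₁, y₂ + y₃, y₁ + y₂ + y₃}
    {y₃, y₁ + y₂, y₁ + y₃} (by
      intro x hx
      simp only [Multiset.insert_eq_cons, Multiset.mem_cons, Multiset.mem_singleton] at hx
      rcases hx with rfl | rfl | rfl
      exacts [hy₁, mem2 hy₂ hy₃, mem2 (mem2 hy₁ hy₂) hy₃]) (by
      intro x hx
      simp only [Multiset.insert_eq_cons, Multiset.mem_cons, Multiset.mem_singleton] at hx
      rcases hx with rfl | rfl | rfl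
      exacts [hy₃, mem2 hy₁ hy₂, mem2 hy₁ hy₃]) (by simp) (by
      refine ⟨by simp, fun k hk => ?_⟩
      have := hno k hk
      simp only [Multiset.insert_eq_cons, Multiset.map_cons, Multiset.map_singleton,
        Multiset.sum_cons, Multiset.sum_singleton, bits, Pi.add_apply, Pi.zero_apply]
      generalize y₁ k = s at this ⊢
      generalize y₂ k = s' at this ⊢
      generalize y₃ k = s'' at this ⊢
      revert this s s' s''
      decide)
  rw [sameSum_pair] at hpair
  have hcard : L.card = 2 := by
    have := hML.1
    simp at this
    omega
  obtain ⟨l, l', rfl⟩ := Multiset.card_eq_two.1 hcard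
  have hl : l ∈ C₁ := hL l (by simp)
  have hl' : l' ∈ C₁ := hL l' (by simp)
  have P : ∀ x ∈ C₁, x p = x e + x a := fun x hx => hp x (hsub x hx)
  have Q : ∀ x ∈ C₁, x q = x e + x b := fun x hx => hq x (hsub x hx)
  have R : ∀ x ∈ C₁, x c = x e + x a + x b := fun x hx => hc x (hsub x hx)
  have pa := hpair a haJ
  have pp := hpair p hpJ
  have pc := hpair c hcJ
  have me := hML.2 e heJ
  have mb := hML.2 b hbJ
  have mq := hML.2 q hqJ
  simp only [Multiset.insert_eq_cons, Multiset.map_cons, Multiset.map_singleton,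
        Multiset.sum_cons, Multiset.sum_singleton, bits, Pi.add_apply, Pi.zero_apply,
        P _ hy₂, P _ hr, P _ hs, Q _ hy₁, Q _ hy₂, Q _ hy₃, Q _ hr, Q _ hl, Q _ hl', R _ hy₂,
        R _ hr, R _ hs, e1, e2, e3, a2, b1, b2, b3] at pa pp pc me mb mq
  -- `r` must be one wherever `y₂` is, which makes it agree with `y₂` on `e`, `a`, `b`. The sums at
  -- `e` and `b` then make `l` and `l'` both one there, so `q = e + b` vanishes on `r`, `l`, `l'`,
  -- although its sum over the original factors is two.
  have ha : r a = 1 := by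
    revert pa; generalize r a = A; generalize s a = B; revert A B; decide
  rw [ha] at pp pc
  have he : r e = 0 := by
    revert pp; generalize r e = A; generalize s e + s a = B; revert A B; decide
  rw [he] at pc me mq
  have hb : r b = 0 := by
    revert pc; generalize r b = A; generalize s e + s a + s b = B; revert A B; decide
  rw [hb] at mb mq
  revert me mb mq
  generalize l e = A
  generalize l b = B
  generalize l' e = A'
  generalize l' b = B'
  revert A B A' B'
  decide

end Words
-- Exclusion of circuits with five or more elements
section Pentagon

variable {ι : Type*} {C : Submodule (ZMod 2) (ι → ZMod 2)} {J : Set ι}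

/-- The coordinates in `D` form a spanning circuit with five elements. -/
structure IsPentagon (C : Submodule (ZMod 2) (ι → ZMod 2)) (J : Set ι) (D : Finset ι) : Prop where
  card : D.card = 5
  subset : ∀ i ∈ D, i ∈ J
  isWord : IsWord C D
  exists_eq : ∀ t : ι → ZMod 2, ∑ i ∈ D, t i = 0 → ∃ x ∈ C, ∀ i ∈ D, x i = t i
  eq_zero : ∀ x ∈ C, (∀ i ∈ D, x i = 0) → ∀ k ∈ J, x k = 0

/-- Some coordinate is the sum of the coordinates `i` and `j`. -/
def HasChord (C : Submodule (ZMod 2) (ι → ZMod 2)) (J : Set ι) (i j : ι) : Prop :=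
  ∃ k ∈ J, ∀ x ∈ C, x k = x i + x j

theorem HasChord.symm {i j : ι} (h : HasChord C J i j) : HasChord C J j i := by
  obtain ⟨k, hk, h⟩ := h
  exact ⟨k, hk, fun x hx => by rw [h x hx, add_comm]⟩

theorem IsPentagon.exists_pair {D : Finset ι} (h : IsPentagon C J D) {i j : ι} (hi : i ∈ D)
    (hj : j ∈ D) (hij : i ≠ j) :
    ∃ y ∈ C, y i = 1 ∧ y j = 1 ∧ ∀ k ∈ D, k ≠ i → k ≠ j → y k = 0 := by
  classical
  obtain ⟨y, hy, hyD⟩ := h.exists_eq (fun k => if k ∈ ({i, j} : Finset ι) then 1 else 0) (by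
    rw [← Finset.sum_filter, Finset.filter_mem_eq_inter,
      Finset.inter_eq_right.2 (by intro k hk; simp at hk; rcases hk with rfl | rfl <;> assumption),
      Finset.sum_pair hij]
    rfl)
  refine ⟨y, hy, ?_, ?_, ?_⟩
  · rw [hyD i hi]; simp
  · rw [hyD j hj]; simp
  · intro k hk h1 h2
    rw [hyD k hk]; simp [h1, h2]

theorem ne_of_card_five [DecidableEq ι] {a b c d e : ι}
    (h : ({a, b, c, d, e} : Finset ι).card = 5) :
    a ≠ b ∧ a ≠ c ∧ a ≠ d ∧ a ≠ e ∧ b ≠ c ∧ b ≠ d ∧ b ≠ e ∧ c ≠ d ∧ c ≠ e ∧ d ≠ e := by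
  have h4 := Finset.card_le_four (a := b) (b := c) (c := d) (d := e)
  have h3 := Finset.card_le_three (a := c) (b := d) (c := e)
  have h2 := Finset.card_le_two (a := d) (b := e)
  have ha : a ∉ ({b, c, d, e} : Finset ι) := fun h' => by
    rw [Finset.insert_eq_of_mem h'] at h; omega
  rw [Finset.card_insert_of_notMem ha] at h
  have hb : b ∉ ({c, d, e} : Finset ι) := fun h' => by
    rw [Finset.insert_eq_of_mem h'] at h; omega
  rw [Finset.card_insert_of_notMem hb] at h
  have hc : c ∉ ({d, e} : Finset ι) := fun h' => by
    rw [Finset.insert_eq_of_mem h'] at h; omega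
  rw [Finset.card_insert_of_notMem hc] at h
  have hd : d ≠ e := by
    rintro rfl
    simp at h
  simp only [Finset.mem_insert, Finset.mem_singleton, not_or] at ha hb hc
  tauto

theorem sum_five [DecidableEq ι] {x : ι → ZMod 2} {a b c d e : ι}
    (h : ({a, b, c, d, e} : Finset ι).card = 5) :
    ∑ i ∈ ({a, b, c, d, e} : Finset ι), x i = x a + x b + x c + x d + x e := by
  obtain ⟨h1, h2, h3, h4, h5, h6, h7, h8, h9, h10⟩ := ne_of_card_five h
  rw [Finset.sum_insert (by simp [*]), Finset.sum_insert (by simp [*]),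
    Finset.sum_insert (by simp [*]), Finset.sum_pair h10]
  ring

/-- Shortening at one of the two remaining elements leaves a four-element circuit with two chords
through `j`, which is `K₄`. -/
theorem IsPentagon.not_codeSK_of_two_chords (hJ : J.Finite) (hC : CodeSK C J) (hN : NoFano C)
    {D : Finset ι} (h : IsPentagon C J D) {i j l : ι} (hi : i ∈ D) (hj : j ∈ D) (hl : l ∈ D)
    (hij : i ≠ j) (hjl : j ≠ l) (hil : i ≠ l) (h₁ : HasChord C J i j) (h₂ : HasChord C J j l) :
    False := by
  classical
  have hsub : ({i, j, l} : Finset ι) ⊆ D := by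
    intro k hk
    simp only [Finset.mem_insert, Finset.mem_singleton] at hk
    rcases hk with rfl | rfl | rfl <;> assumption
  have h3 : ({i, j, l} : Finset ι).card = 3 := by
    simp [Finset.card_insert_of_notMem, hij, hjl, hil]
  obtain ⟨m, n, hmn, hD⟩ := Finset.card_eq_two.1 (show (D \ {i, j, l}).card = 2 by
    rw [Finset.card_sdiff_of_subset hsub, h.card, h3])
  have hD' : D = {i, j, l, m, n} := by
    rw [← Finset.union_sdiff_of_subset hsub, hD]
    ext; simp only [Finset.mem_union, Finset.mem_insert, Finset.mem_singleton]; tauto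
  have h5 := h.card
  rw [hD'] at h5
  obtain ⟨-, -, him, hin, -, hjm, hjn, hlm, hln, -⟩ := ne_of_card_five h5
  have hm : m ∈ D := by simp [hD']
  have hn : n ∈ D := by simp [hD']
  obtain ⟨p, hp, hpx⟩ := h₁
  obtain ⟨q, hq, hqx⟩ := h₂
  have hw := h.isWord
  rw [IsWord, hD'] at hw
  obtain ⟨y, hy, hy1, hym, hy0⟩ := h.exists_pair hj hm hjm
  obtain ⟨z, hz, hz1, hzm, hz0⟩ := h.exists_pair hi hm him
  obtain ⟨w, hw', hw1, hwm, hw0⟩ := h.exists_pair hl hm hlm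
  refine not_codeSK_of_completeGraph_four hJ
    (codeSK_shorten (F := {n}) hC (by simpa using h.subset n hn)) (hN.shorten {n}) (e := j) (a := i)
    (b := l) (c := m) (p := p) (q := q) (h.subset _ hj) (h.subset _ hi) (h.subset _ hl)
    (h.subset _ hm) hp hq ?_ (fun x hx => by rw [hpx x hx.1, add_comm]) (fun x hx => hqx x hx.1)
    ⟨y, ⟨hy, ?_⟩, hy1, hy0 i hi hij him, hy0 l hl hjl.symm hlm⟩
    ⟨z, ⟨hz, ?_⟩, hz0 j hj hij.symm hjm, hz1, hz0 l hl hil.symm hlm⟩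
    ⟨w, ⟨hw', ?_⟩, hw0 j hj hjl hjm, hw0 i hi hil him, hw1⟩
  · rintro x ⟨hx, hx0⟩
    have h1 := hw x hx
    have h2 := hx0 n rfl
    rw [sum_five h5, h2] at h1
    revert h1
    generalize x i = A
    generalize x j = B
    generalize x l = B'
    generalize x m = B''
    revert A B B' B''
    decide
  all_goals
    rintro k hk
    rw [Set.mem_singleton_iff] at hk
    subst hk
  · exact hy0 k hn hjn.symm hmn.symm
  · exact hz0 k hn hin.symm hmn.symm
  · exact hw0 k hn hln.symm hmn.symm

/-- Only `d₁d₂` and `d₃d₄` can be chords. Let `yᵢ` be the word supported in `D` on `dᵢ` and `d₅`.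
The relation `0·(y₁+y₂+y₃)·(y₂+y₃+y₄) = (y₁+y₂+y₃+y₄)·y₃·y₂`, written with products of generators,
can fail only at a coordinate that is one of the excluded chords, and it has no exchange. -/
theorem IsPentagon.not_codeSK_of_matching [DecidableEq ι] (hC : CodeSK C J) {D : Finset ι}
    (h : IsPentagon C J D) {d₁ d₂ d₃ d₄ d₅ : ι} (hD : D = {d₁, d₂, d₃, d₄, d₅})
    (h13 : ¬ HasChord C J d₁ d₃) (h14 : ¬ HasChord C J d₁ d₄) (h23 : ¬ HasChord C J d₂ d₃)
    (h24 : ¬ HasChord C J d₂ d₄) (h15 : ¬ HasChord C J d₁ d₅) (h25 : ¬ HasChord C J d₂ d₅)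
    (h35 : ¬ HasChord C J d₃ d₅) (h45 : ¬ HasChord C J d₄ d₅) : False := by
  have h5 := h.card
  rw [hD] at h5
  obtain ⟨n12, n13, n14, n15, n23, n24, n25, n34, n35, n45⟩ := ne_of_card_five h5
  have m1 : d₁ ∈ D := by simp [hD]
  have m2 : d₂ ∈ D := by simp [hD]
  have m3 : d₃ ∈ D := by simp [hD]
  have m4 : d₄ ∈ D := by simp [hD]
  have m5 : d₅ ∈ D := by simp [hD]
  have hw := h.isWord
  rw [IsWord, hD] at hw
  simp only [sum_five h5] at hw
  obtain ⟨y₁, hy₁, a1, a5, a0⟩ := h.exists_pair m1 m5 n15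
  have a2 := a0 _ m2 n12.symm n25
  have a3 := a0 _ m3 n13.symm n35
  have a4 := a0 _ m4 n14.symm n45
  obtain ⟨y₂, hy₂, b2, b5, b0⟩ := h.exists_pair m2 m5 n25
  have b1 := b0 _ m1 n12 n15
  have b3 := b0 _ m3 n23.symm n35
  have b4 := b0 _ m4 n24.symm n45
  obtain ⟨y₃, hy₃, c3, c5, c0⟩ := h.exists_pair m3 m5 n35
  have c1 := c0 _ m1 n13 n15
  have c2 := c0 _ m2 n23 n25
  have c4 := c0 _ m4 n34.symm n45
  obtain ⟨y₄, hy₄, e4, e5, e0⟩ := h.exists_pair m4 m5 n45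
  have e1 := e0 _ m1 n14 n15
  have e2 := e0 _ m2 n24 n25
  have e3 := e0 _ m3 n34 n35
  have hspan : ∀ k ∈ J, ∀ x ∈ C,
      x k = x d₁ * y₁ k + x d₂ * y₂ k + x d₃ * y₃ k + x d₄ * y₄ k := by
    intro k hk x hx
    have hz := h.eq_zero (x + x d₁ • y₁ + x d₂ • y₂ + x d₃ • y₃ + x d₄ • y₄)
      (add_mem (add_mem (add_mem (add_mem hx (C.smul_mem _ hy₁)) (C.smul_mem _ hy₂))
        (C.smul_mem _ hy₃)) (C.smul_mem _ hy₄)) (by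
        intro i hi
        rw [hD] at hi
        simp only [Finset.mem_insert, Finset.mem_singleton] at hi
        rcases hi with rfl | rfl | rfl | rfl | rfl
        · simp [a1, b1, c1, e1, CharTwo.add_self_eq_zero]
        · simp [a2, b2, c2, e2, CharTwo.add_self_eq_zero]
        · simp [a3, b3, c3, e3, CharTwo.add_self_eq_zero]
        · simp [a4, b4, c4, e4, CharTwo.add_self_eq_zero]
        · have := hw x hx
          simp only [Pi.add_apply, Pi.smul_apply, smul_eq_mul, a5, b5, c5, e5, mul_one]
          rw [← this]; ring) k hk
    simp only [Pi.add_apply, Pi.smul_apply, smul_eq_mul] at hz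
    rw [add_assoc, add_assoc, add_assoc] at hz
    rw [CharTwo.add_eq_zero.1 hz]
    ring
  have chord : ∀ k ∈ J, ∀ i j, ¬ HasChord C J i j →
      ¬ ∀ x ∈ C, x d₁ * y₁ k + x d₂ * y₂ k + x d₃ * y₃ k + x d₄ * y₄ k = x i + x j :=
    fun k hk i j hij hx => hij ⟨k, hk, fun x hxC => (hspan k hk x hxC).trans (hx x hxC)⟩
  have e5' : ∀ x ∈ C, x d₅ = x d₁ + x d₂ + x d₃ + x d₄ := fun x hx =>
    (CharTwo.add_eq_zero.1 (hw x hx)).symm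
  have hsum : ∀ k ∈ J, bits 0 k + (bits (y₁ + y₂ + y₃) k + bits (y₂ + y₃ + y₄) k) =
      bits (y₁ + y₂ + y₃ + y₄) k + (bits y₃ k + bits y₂ k) := by
    intro k hk
    have f13 : ¬ (y₁ k = 1 ∧ y₂ k = 0 ∧ y₃ k = 1 ∧ y₄ k = 0) := by
      rintro ⟨k1, k2, k3, k4⟩
      refine chord k hk _ _ h13 fun x hx => ?_
      rw [k1, k2, k3, k4]
      grind
    have f14 : ¬ (y₁ k = 1 ∧ y₂ k = 0 ∧ y₃ k = 0 ∧ y₄ k = 1) := by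
      rintro ⟨k1, k2, k3, k4⟩
      refine chord k hk _ _ h14 fun x hx => ?_
      rw [k1, k2, k3, k4]
      grind
    have f23 : ¬ (y₁ k = 0 ∧ y₂ k = 1 ∧ y₃ k = 1 ∧ y₄ k = 0) := by
      rintro ⟨k1, k2, k3, k4⟩
      refine chord k hk _ _ h23 fun x hx => ?_
      rw [k1, k2, k3, k4]
      grind
    have f24 : ¬ (y₁ k = 0 ∧ y₂ k = 1 ∧ y₃ k = 0 ∧ y₄ k = 1) := by
      rintro ⟨k1, k2, k3, k4⟩
      refine chord k hk _ _ h24 fun x hx => ?_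
      rw [k1, k2, k3, k4]
      grind
    have f15 : ¬ (y₁ k = 0 ∧ y₂ k = 1 ∧ y₃ k = 1 ∧ y₄ k = 1) := by
      rintro ⟨k1, k2, k3, k4⟩
      refine chord k hk _ _ h15 fun x hx => ?_
      rw [k1, k2, k3, k4, e5' x hx]
      grind
    have f25 : ¬ (y₁ k = 1 ∧ y₂ k = 0 ∧ y₃ k = 1 ∧ y₄ k = 1) := by
      rintro ⟨k1, k2, k3, k4⟩
      refine chord k hk _ _ h25 fun x hx => ?_
      rw [k1, k2, k3, k4, e5' x hx]
      grind
    have f35 : ¬ (y₁ k = 1 ∧ y₂ k = 1 ∧ y₃ k = 0 ∧ y₄ k = 1) := by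
      rintro ⟨k1, k2, k3, k4⟩
      refine chord k hk _ _ h35 fun x hx => ?_
      rw [k1, k2, k3, k4, e5' x hx]
      grind
    have f45 : ¬ (y₁ k = 1 ∧ y₂ k = 1 ∧ y₃ k = 1 ∧ y₄ k = 0) := by
      rintro ⟨k1, k2, k3, k4⟩
      refine chord k hk _ _ h45 fun x hx => ?_
      rw [k1, k2, k3, k4, e5' x hx]
      grind
    simp only [bits, Pi.add_apply, Pi.zero_apply]
    generalize y₁ k = A at *
    generalize y₂ k = B at *
    generalize y₃ k = A' at *
    generalize y₄ k = B' at *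
    clear chord
    rcases zmod_two_eq A with rfl | rfl <;> rcases zmod_two_eq B with rfl | rfl <;>
      rcases zmod_two_eq A' with rfl | rfl <;> rcases zmod_two_eq B' with rfl | rfl <;>
      first
        | rfl
        | exact (f13 ⟨rfl, rfl, rfl, rfl⟩).elim
        | exact (f14 ⟨rfl, rfl, rfl, rfl⟩).elim
        | exact (f23 ⟨rfl, rfl, rfl, rfl⟩).elim
        | exact (f24 ⟨rfl, rfl, rfl, rfl⟩).elim
        | exact (f15 ⟨rfl, rfl, rfl, rfl⟩).elim
        | exact (f25 ⟨rfl, rfl, rfl, rfl⟩).elim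
        | exact (f35 ⟨rfl, rfl, rfl, rfl⟩).elim
        | exact (f45 ⟨rfl, rfl, rfl, rfl⟩).elim
  have mem2 : ∀ {x y : ι → ZMod 2}, x ∈ C → y ∈ C → x + y ∈ C := C.add_mem
  obtain ⟨p, hp, q, hq, L, hL, hpair, hML⟩ := hC 0 C.zero_mem (y₁ + y₂ + y₃ + y₄)
    (mem2 (mem2 (mem2 hy₁ hy₂) hy₃) hy₄) {y₁ + y₂ + y₃, y₂ + y₃ + y₄} {y₃, y₂}
    (mem_of_mem_pair (mem2 (mem2 hy₁ hy₂) hy₃) (mem2 (mem2 hy₂ hy₃) hy₄))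
    (mem_of_mem_pair hy₃ hy₂) (by simp) ⟨by simp, fun k hk => by simpa using hsum k hk⟩
  rw [sameSum_pair] at hpair
  obtain ⟨l, rfl⟩ : ∃ l, L = {l} := Multiset.card_eq_one.1 (by simpa using hML.1.symm)
  have key : ∀ a b : ZMod 2, ZMod.val (0 : ZMod 2) + a.val = ZMod.val (1 : ZMod 2) + b.val →
      a = 1 := by decide
  have p1 := hpair _ (h.subset _ m1)
  have p2 := hpair _ (h.subset _ m2)
  have p3 := hpair _ (h.subset _ m3)
  have p4 := hpair _ (h.subset _ m4)
  have l5 := hML.2 _ (h.subset _ m5)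
  simp only [bits, Pi.add_apply, Pi.zero_apply, a1, a2, a3, a4, b1, b2, b3, b4, c1, c2, c3, c4, e1,
    e2, e3, e4, add_zero, zero_add] at p1 p2 p3 p4
  -- `p` is one at `d₁, …, d₄`, hence zero at `d₅` by parity. Both factors of the left side are one
  -- at `d₅`, and the single word `l` cannot supply a sum of two.
  have p5 : p d₅ = 0 := by
    rw [e5' p hp, key _ _ p1, key _ _ p2, key _ _ p3, key _ _ p4]; rfl
  simp only [Multiset.insert_eq_cons, Multiset.map_cons, Multiset.map_singleton,
    Multiset.sum_cons, Multiset.sum_singleton, bits, Pi.add_apply, a5, b5, c5, e5, p5] at l5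
  revert l5
  generalize l d₅ = a
  revert a
  decide

/-- Two chords with a common element give `K₄`, so the chords form a matching of the five elements,
and these can be ordered as `IsPentagon.not_codeSK_of_matching` requires. -/
theorem IsPentagon.false (hJ : J.Finite) (hC : CodeSK C J) (hN : NoFano C) {D : Finset ι}
    (h : IsPentagon C J D) : False := by
  classical
  have two : ∀ {i j l : ι}, i ∈ D → j ∈ D → l ∈ D → i ≠ j → j ≠ l → i ≠ l → HasChord C J i j →
      ¬ HasChord C J j l := fun hi hj hl hij hjl hil h₁ h₂ =>
    h.not_codeSK_of_two_chords hJ hC hN hi hj hl hij hjl hil h₁ h₂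
  have noChord : ∀ i ∈ D, ∀ j ∈ D, i ≠ j → ¬ HasChord C J i j := by
    intro i hi j hj hij hc
    have hsub : ({i, j} : Finset ι) ⊆ D := by
      intro k hk
      simp only [Finset.mem_insert, Finset.mem_singleton] at hk
      rcases hk with rfl | rfl <;> assumption
    obtain ⟨k, l, m, hkl, hkm, hlm, hD⟩ := Finset.card_eq_three.1 (show (D \ {i, j}).card = 3 by
      rw [Finset.card_sdiff_of_subset hsub, h.card, Finset.card_pair hij])
    have hD' : D = {i, j, k, l, m} := by
      rw [← Finset.union_sdiff_of_subset hsub, hD]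
      ext; simp only [Finset.mem_union, Finset.mem_insert, Finset.mem_singleton]; tauto
    have hk : k ∈ D := by simp [hD']
    have hl : l ∈ D := by simp [hD']
    have hm : m ∈ D := by simp [hD']
    have h5 := h.card
    rw [hD'] at h5
    obtain ⟨-, hik, hil, him, hjk, hjl, hjm, -, -, -⟩ := ne_of_card_five h5
    have J' : ∀ x ∈ D, j ≠ x → i ≠ x → ¬ HasChord C J j x := fun x hx h1 h2 =>
      two hi hj hx hij h1 h2 hc
    have I' : ∀ x ∈ D, j ≠ x → i ≠ x → ¬ HasChord C J i x := fun x hx h1 h2 =>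
      two hj hi hx hij.symm h2 h1 hc.symm
    by_cases hkm' : HasChord C J k m
    · refine h.not_codeSK_of_matching hC (d₁ := i) (d₂ := j) (d₃ := k) (d₄ := m) (d₅ := l) ?_
        (I' k hk hjk hik) (I' m hm hjm him) (J' k hk hjk hik) (J' m hm hjm him) (I' l hl hjl hil)
        (J' l hl hjl hil) (two hm hk hl hkm.symm hkl hlm.symm hkm'.symm)
        (two hk hm hl hkm hlm.symm hkl hkm')
      rw [hD']
      ext; simp only [Finset.mem_insert, Finset.mem_singleton]; tauto
    by_cases hlm' : HasChord C J l m
    · refine h.not_codeSK_of_matching hC (d₁ := i) (d₂ := j) (d₃ := l) (d₄ := m) (d₅ := k) ?_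
        (I' l hl hjl hil) (I' m hm hjm him) (J' l hl hjl hil) (J' m hm hjm him) (I' k hk hjk hik)
        (J' k hk hjk hik) (two hm hl hk hlm.symm hkl.symm hkm.symm hlm'.symm)
        (two hl hm hk hlm hkm.symm hkl.symm hlm')
      rw [hD']
      ext; simp only [Finset.mem_insert, Finset.mem_singleton]; tauto
    exact h.not_codeSK_of_matching hC hD' (I' k hk hjk hik) (I' l hl hjl hil) (J' k hk hjk hik)
      (J' l hl hjl hil) (I' m hm hjm him) (J' m hm hjm him) hkm' hlm'
  obtain ⟨a, t, hat, rfl, h4⟩ := Finset.card_eq_succ.1 h.card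
  obtain ⟨b, t, hbt, rfl, h3⟩ := Finset.card_eq_succ.1 h4
  obtain ⟨c, d, e, hcd, hce, hde, rfl⟩ := Finset.card_eq_three.1 h3
  obtain ⟨n12, n13, n14, n15, n23, n24, n25, n34, n35, n45⟩ := ne_of_card_five h.card
  refine h.not_codeSK_of_matching hC rfl ?_ ?_ ?_ ?_ ?_ ?_ ?_ ?_ <;>
    refine noChord _ (by simp) _ (by simp) ?_ <;> assumption

/-- The dual code of a strongly Koszul code without Fano minor has no circuit with five or more
elements. -/
theorem IsCircuit.card_le_four (hJ : J.Finite) (hC : CodeSK C J) (hN : NoFano C) {w : Finset ι}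
    (hw : IsCircuit C w) (hwJ : (w : Set ι) ⊆ J) : w.card ≤ 4 := by
  classical
  by_contra hcard
  -- Any five elements of `w` form a circuit once the others are contracted, and further shortening
  -- makes it spanning.
  obtain ⟨D, hDw, hD⟩ := Finset.exists_subset_card_eq (show 5 ≤ w.card by omega)
  set C₀ := shorten ((w \ D : Finset ι) : Set ι) C with hC₀
  have hF₀ : ((w \ D : Finset ι) : Set ι) ⊆ J := fun i hi =>
    hwJ (Finset.mem_sdiff.1 (Finset.mem_coe.1 hi)).1
  have hSK : CodeSK C₀ J := codeSK_shorten hC hF₀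
  obtain ⟨F, hFJ, hF1, hF2⟩ := exists_shorten_injOn C₀ (D : Set ι) hJ
  refine IsPentagon.false (D := D) hJ (codeSK_shorten hSK hFJ) ((hN.shorten _).shorten F)
    ⟨hD, fun i hi => hwJ (hDw hi), ?_, ?_, hF2⟩
  · intro x hx
    have h1 := hw.1 x hx.1.1
    rw [← Finset.sum_sdiff hDw, Finset.sum_eq_zero fun i hi => hx.1.2 i (Finset.mem_coe.2 hi),
      zero_add] at h1
    exact h1
  · intro t ht
    obtain ⟨x, hx, hxt⟩ := exists_mem_eqOn_of_dual C w (fun i => if i ∈ D then t i else 0) (by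
      intro w' hw' hword
      rcases hw.2.2 w' hw' hword with rfl | rfl
      · simp
      · rw [← Finset.sum_filter, Finset.filter_mem_eq_inter, Finset.inter_eq_right.2 hDw, ht])
    have hx0 : x ∈ C₀ := ⟨hx, fun i hi => by
      have := Finset.mem_sdiff.1 (Finset.mem_coe.1 hi)
      rw [hxt i this.1, if_neg this.2]⟩
    obtain ⟨y, hy, hyx⟩ := hF1 x hx0
    exact ⟨y, hy, fun i hi => by rw [hyx i hi, hxt i (hDw hi), if_pos hi]⟩

end Pentagon
/-! ### The cut code of the complete bipartite graph with two vertices on one side -/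

section Twin

variable {I : Type*}

/-- The cut vectors of `K_{2,I}`: the first entry tells whether the two vertices on the first side
are separated, the second one gives the cut of the edges at one of these vertices. -/
def twinVec (z : ZMod 2 × (I → ZMod 2)) : I ⊕ I → ℕ :=
  Sum.elim (fun i => (z.2 i).val) (fun i => (z.2 i + z.1).val)

/-- The number of elements of `M` with first entry `t`. -/
def twinCount (t : ZMod 2) (M : Multiset (ZMod 2 × (I → ZMod 2))) : ℕ :=
  (M.map fun z => if z.1 = t then 1 else 0).sum

/-- The sum of the coordinates `i` of the elements of `M` with first entry `t`. -/
def twinSum (t : ZMod 2) (M : Multiset (ZMod 2 × (I → ZMod 2))) (i : I) : ℕ :=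
  (M.map fun z => if z.1 = t then (z.2 i).val else 0).sum

theorem twinCount_cons (t : ZMod 2) (z : ZMod 2 × (I → ZMod 2)) (M) :
    twinCount t (z ::ₘ M) = (if z.1 = t then 1 else 0) + twinCount t M := by
  simp [twinCount]

theorem twinSum_cons (t : ZMod 2) (z : ZMod 2 × (I → ZMod 2)) (M) (i : I) :
    twinSum t (z ::ₘ M) i = (if z.1 = t then (z.2 i).val else 0) + twinSum t M i := by
  simp [twinSum]

theorem twinSum_le (t : ZMod 2) (M : Multiset (ZMod 2 × (I → ZMod 2))) (i : I) :
    twinSum t M i ≤ twinCount t M := by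
  refine Multiset.sum_map_le_sum_map _ _ fun z _ => ?_
  have := ZMod.val_lt (z.2 i)
  split_ifs <;> omega

theorem card_eq_twinCount (M : Multiset (ZMod 2 × (I → ZMod 2))) :
    M.card = twinCount 0 M + twinCount 1 M := by
  induction M using Multiset.induction with
  | empty => simp [twinCount]
  | cons z M ih =>
    rw [twinCount_cons, twinCount_cons, Multiset.card_cons, ih]
    rcases zmod_two_eq z.1 with h | h <;> simp [h] <;> omega

theorem sum_twinVec_inl (M : Multiset (ZMod 2 × (I → ZMod 2))) (i : I) :
    (M.map fun z => twinVec z (Sum.inl i)).sum = twinSum 0 M i + twinSum 1 M i := by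
  induction M using Multiset.induction with
  | empty => simp [twinSum]
  | cons z M ih =>
    rw [twinSum_cons, twinSum_cons, Multiset.map_cons, Multiset.sum_cons, ih]
    rcases zmod_two_eq z.1 with h | h <;> simp [h, twinVec] <;> omega

/-- A vector with first entry one has complementary values at `inl i` and `inr i`; the subtraction
is moved to the other side. -/
theorem sum_twinVec_inr (M : Multiset (ZMod 2 × (I → ZMod 2))) (i : I) :
    (M.map fun z => twinVec z (Sum.inr i)).sum + twinSum 1 M i =
      twinSum 0 M i + twinCount 1 M := by
  induction M using Multiset.induction with
  | empty => simp [twinSum, twinCount]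
  | cons z M ih =>
    rw [twinSum_cons, twinSum_cons, twinCount_cons, Multiset.map_cons, Multiset.sum_cons]
    have key : ∀ a : ZMod 2, (a + 1).val + a.val = 1 := by decide
    have := key (z.2 i)
    simp only [twinVec, Sum.elim_inr] at ih ⊢
    rcases zmod_two_eq z.1 with h | h <;> simp [h] <;> omega

theorem sameSum_twinVec_of_eq {M N : Multiset (ZMod 2 × (I → ZMod 2))}
    (hc : ∀ t, twinCount t M = twinCount t N) (hs : ∀ t i, twinSum t M i = twinSum t N i) :
    SameSum twinVec Set.univ M N := by
  refine ⟨by rw [card_eq_twinCount, card_eq_twinCount, hc, hc], ?_⟩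
  rintro (i | i) -
  · rw [sum_twinVec_inl, sum_twinVec_inl, hs, hs]
  · have h1 := sum_twinVec_inr M i
    have h2 := sum_twinVec_inr N i
    rw [hs, hs, hc] at h1
    omega

/-- With counts `k₀`, `k₁` and sums `σ₀`, `σ₁`, a relation preserves `k₀ + k₁`, `σ₀ + σ₁` and `σ₀ +
k₁ - σ₁`, hence `2σₜ - kₜ` for each `t`, though not `σₜ` and `kₜ` separately. -/
theorem SameSum.twin_invariant {M N : Multiset (ZMod 2 × (I → ZMod 2))}
    (h : SameSum twinVec Set.univ M N) (t : ZMod 2) (i : I) :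
    2 * twinSum t M i + twinCount t N = 2 * twinSum t N i + twinCount t M := by
  have h0 := h.1
  have h1 := h.2 (Sum.inl i) trivial
  have h2 := h.2 (Sum.inr i) trivial
  have h3 := sum_twinVec_inr M i
  have h4 := sum_twinVec_inr N i
  rw [card_eq_twinCount, card_eq_twinCount] at h0
  rw [sum_twinVec_inl, sum_twinVec_inl] at h1
  rcases zmod_two_eq t with rfl | rfl <;> omega

/-- Greedy choice: each vector takes a one wherever the remaining demand is positive. -/
theorem exists_twin_single (t : ZMod 2) (k : ℕ) (α : I → ℕ) (hα : ∀ i, α i ≤ k) :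
    ∃ L : Multiset (ZMod 2 × (I → ZMod 2)), twinCount t L = k ∧ (∀ i, twinSum t L i = α i) ∧
      ∀ s, s ≠ t → twinCount s L = 0 ∧ ∀ i, twinSum s L i = 0 := by
  induction k generalizing α with
  | zero => exact ⟨0, by simp [twinCount, twinSum, fun i => Nat.le_zero.1 (hα i)]⟩
  | succ k ih =>
    obtain ⟨L, hL, hLα, hL0⟩ := ih (fun i => α i - 1) fun i => by have := hα i; omega
    refine ⟨(t, fun i => if α i = 0 then 0 else 1) ::ₘ L, ?_, fun i => ?_, fun s hs => ?_⟩
    · rw [twinCount_cons, hL]; simp; omega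
    · rw [twinSum_cons, hLα]
      by_cases h : α i = 0 <;> simp [h, ZMod.val_one]; omega
    · simp only [twinCount_cons, twinSum_cons, hL0 s hs, if_neg hs.symm, implies_true, and_self]

theorem exists_twin (k : ZMod 2 → ℕ) (α : ZMod 2 → I → ℕ) (hα : ∀ t i, α t i ≤ k t) :
    ∃ L : Multiset (ZMod 2 × (I → ZMod 2)), (∀ t, twinCount t L = k t) ∧
      ∀ t i, twinSum t L i = α t i := by
  obtain ⟨L₀, h1, h2, h3⟩ := exists_twin_single 0 (k 0) (α 0) (hα 0)
  obtain ⟨L₁, h1', h2', h3'⟩ := exists_twin_single 1 (k 1) (α 1) (hα 1)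
  have e0 := h3 1 (by decide)
  have e1 := h3' 0 (by decide)
  simp only [twinCount, twinSum] at *
  refine ⟨L₀ + L₁, fun t => ?_, fun t i => ?_⟩
  · rcases zmod_two_eq t with rfl | rfl <;>
      simp only [Multiset.map_add, Multiset.sum_add, *, add_zero, zero_add]
  · rcases zmod_two_eq t with rfl | rfl <;>
      simp only [Multiset.map_add, Multiset.sum_add, *, add_zero, zero_add]

/-- Any counts and sums with `σ ≤ k` are realised, so `z` splits off as soon as its removal leaves
sums between zero and the reduced count. -/
theorem exists_sameSum_twin_cons (M : Multiset (ZMod 2 × (I → ZMod 2)))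
    (z : ZMod 2 × (I → ZMod 2)) (hc : 1 ≤ twinCount z.1 M)
    (hz : ∀ i, (z.2 i).val ≤ twinSum z.1 M i ∧
      twinSum z.1 M i ≤ (z.2 i).val + (twinCount z.1 M - 1)) :
    ∃ L, SameSum twinVec Set.univ M (z ::ₘ L) := by
  obtain ⟨L, hL, hL'⟩ := exists_twin (fun t => twinCount t M - if z.1 = t then 1 else 0)
    (fun t i => twinSum t M i - if z.1 = t then (z.2 i).val else 0) (by
      intro t i
      by_cases h : z.1 = t
      · subst h
        have := hz i
        simp only [if_true]
        omega
      · simpa [h] using twinSum_le t M i)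
  refine ⟨L, sameSum_twinVec_of_eq (fun t => ?_) (fun t i => ?_)⟩
  · rw [twinCount_cons, hL]
    by_cases h : z.1 = t
    · subst h
      simp only [if_true]
      omega
    · simp [h]
  · rw [twinSum_cons, hL']
    by_cases h : z.1 = t
    · subst h
      have := hz i
      simp only [if_true]
      omega
    · simp [h]

theorem exists_exchange_of_mem {κ ι : Type*} {c : κ → ι → ℕ} {J : Set ι} {u v : κ} {M : Multiset κ}
    (h : SameSum c J {u} {v}) (hM : M ≠ 0) :
    ∃ p q L, SameSum c J {u, p} {v, q} ∧ SameSum c J M (p ::ₘ L) := by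
  obtain ⟨p, hp⟩ := Multiset.exists_mem_of_ne_zero hM
  obtain ⟨L, rfl⟩ := Multiset.exists_cons_of_mem hp
  exact ⟨p, p, L, h.add (SameSum.refl c J {p}), SameSum.refl _ _ _⟩

/-- `p` must take the values of `v` where `u` and `v` differ and is free elsewhere. Invariance of
`2σ - k`, together with the inequality of counts, makes those values available in `M`. -/
theorem exists_exchange_twin_same {u v : ZMod 2 × (I → ZMod 2)}
    {M N : Multiset (ZMod 2 × (I → ZMod 2))} (hM : M ≠ 0)
    (h : SameSum twinVec Set.univ (u ::ₘ M) (v ::ₘ N)) (huv : u.1 = v.1)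
    (hle : twinCount u.1 (v ::ₘ N) ≤ twinCount u.1 (u ::ₘ M)) :
    ∃ p q L, SameSum twinVec Set.univ {u, p} {v, q} ∧ SameSum twinVec Set.univ M (p ::ₘ L) := by
  by_cases hne : u.2 = v.2
  · obtain rfl : u = v := Prod.ext huv hne
    exact exists_exchange_of_mem (SameSum.refl _ _ _) hM
  obtain ⟨t, φ⟩ := u
  obtain ⟨t', ψ⟩ := v
  simp only at huv hle hne
  subst huv
  have inv := fun i => h.twin_invariant t i
  simp only [twinCount_cons, twinSum_cons, if_true] at inv hle
  have hN := fun i => twinSum_le t N i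
  have hM' := fun i => twinSum_le t M i
  have hφ := fun i => ZMod.val_lt (φ i)
  have hψ := fun i => ZMod.val_lt (ψ i)
  have hval : ∀ a b : ZMod 2, a ≠ b → a.val = 0 ∧ b.val = 1 ∨ a.val = 1 ∧ b.val = 0 := by decide
  obtain ⟨L, hL⟩ := exists_sameSum_twin_cons M
    (t, fun i => if φ i = ψ i then (if twinSum t M i = 0 then 0 else 1) else ψ i) (by
      obtain ⟨i, hi⟩ := Function.ne_iff.1 hne
      have h1 := inv i
      have h2 := hN i
      have h3 := hval _ _ hi
      have h4 := hM' i
      simp only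
      omega) (by
      intro i
      have h1 := inv i
      have h2 := hN i
      have h4 := hM' i
      simp only
      by_cases hi : φ i = ψ i
      · by_cases h0 : twinSum t M i = 0
        · simp [hi, h0]
        · simp [hi, h0, ZMod.val_one]
          omega
      · have h3 := hval _ _ hi
        simp only [if_neg hi]
        omega)
  refine ⟨_, (t, fun i => if φ i = ψ i then (if twinSum t M i = 0 then 0 else 1) else φ i), L, ?_,
    hL⟩
  rw [sameSum_pair]
  rintro (i | i) - <;> by_cases hi : φ i = ψ i <;> simp [twinVec, hi, add_comm]

/-- If the class of `v` has more members in `M` than in `N`, then `v` itself splits off from `M`.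
Otherwise `u` and `v` are each paired with the complement in their own class: both pairs sum to the
all-one vector. -/
theorem exists_exchange_twin_ne {u v : ZMod 2 × (I → ZMod 2)}
    {M N : Multiset (ZMod 2 × (I → ZMod 2))} (hM : M ≠ 0)
    (h : SameSum twinVec Set.univ (u ::ₘ M) (v ::ₘ N)) (huv : u.1 ≠ v.1) :
    ∃ p q L, SameSum twinVec Set.univ {u, p} {v, q} ∧ SameSum twinVec Set.univ M (p ::ₘ L) := by
  rcases isEmpty_or_nonempty I with hI | ⟨⟨i₀⟩⟩
  · exact exists_exchange_of_mem ⟨rfl, fun i => isEmptyElim i⟩ hM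
  obtain ⟨t, φ⟩ := u
  obtain ⟨r, ψ⟩ := v
  simp only at huv
  have invt := fun i => h.twin_invariant t i
  have invr := fun i => h.twin_invariant r i
  simp only [twinCount_cons, twinSum_cons, if_true, if_neg huv, if_neg huv.symm, zero_add]
    at invt invr
  have hN := fun i => twinSum_le r N i
  have hNt := fun i => twinSum_le t N i
  have hMr := fun i => twinSum_le r M i
  have hM' := fun i => twinSum_le t M i
  have hφ := fun i => ZMod.val_lt (φ i)
  have hψ := fun i => ZMod.val_lt (ψ i)
  have hadd : ∀ a : ZMod 2, a.val + (a + 1).val = 1 := by decide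
  have hcard : 1 + twinCount t M + twinCount r M = 1 + twinCount r N + twinCount t N := by
    have := h.1
    rw [card_eq_twinCount, card_eq_twinCount] at this
    simp only [twinCount_cons] at this
    rcases zmod_two_eq t with rfl | rfl <;> rcases zmod_two_eq r with rfl | rfl <;>
      simp at this huv ⊢ <;> omega
  by_cases hle : 1 + twinCount r N ≤ twinCount r M
  · obtain ⟨L, hL⟩ := exists_sameSum_twin_cons M (r, ψ) (by simp only; omega) (by
      intro i
      have h1 := invr i
      have h2 := hN i
      have h3 := hψ i
      simp only
      omega)
    exact ⟨(r, ψ), (t, φ), L, sameSum_pair.2 fun i _ => add_comm _ _, hL⟩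
  · obtain ⟨L, hL⟩ := exists_sameSum_twin_cons M (t, fun i => φ i + 1) (by
      have h1 := invt i₀
      have h2 := hNt i₀
      have h3 := hφ i₀
      simp only
      omega) (by
      intro i
      have h1 := invt i
      have h2 := hNt i
      have h3 := hφ i
      have h4 := hadd (φ i)
      have h5 := hM' i
      simp only
      omega)
    refine ⟨_, (r, fun i => ψ i + 1), L, sameSum_pair.2 ?_, hL⟩
    rintro (i | i) -
    · simp [twinVec, hadd]
    · have := hadd (φ i + t)
      have := hadd (ψ i + r)
      simp only [twinVec, Sum.elim_inr]
      rw [add_right_comm (φ i), add_right_comm (ψ i)]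
      omega

theorem stronglyKoszulOn_twinVec : StronglyKoszulOn (twinVec (I := I)) Set.univ Set.univ := by
  intro u _ v _ M N _ _ hM h
  suffices ∃ p q L, SameSum twinVec Set.univ {u, p} {v, q} ∧
      SameSum twinVec Set.univ M (p ::ₘ L) by
    obtain ⟨p, q, L, h1, h2⟩ := this
    exact ⟨p, trivial, q, trivial, L, fun _ _ => trivial, h1, h2⟩
  by_cases huv : u.1 = v.1
  · rcases le_total (twinCount u.1 (v ::ₘ N)) (twinCount u.1 (u ::ₘ M)) with hle | hle
    · exact exists_exchange_twin_same hM h huv hle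
    -- The counts point the other way: exchange from the side of `N` and carry the result over by
    -- `SameSum.cancel_left`.
    · have hN : N ≠ 0 := by
        rintro rfl
        have := h.1
        simp at this
        exact hM this
      rw [huv] at hle
      obtain ⟨p, q, L, h1, h2⟩ := exists_exchange_twin_same hN h.symm huv.symm hle
      exact ⟨q, p, L, h1.symm, h.symm.cancel_left h1 h2⟩
  · exact exists_exchange_twin_ne hM h huv

end Twin
/-! ### Deletion of a coordinate -/

section Deletion

variable {ι : Type*} {C : Submodule (ZMod 2) (ι → ZMod 2)}

theorem stronglyKoszulOn_of_subset {κ ι : Type*} {c : κ → ι → ℕ} {P P' : Set κ} {J : Set ι}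
    (hP : P ⊆ P') (h : ∀ y ∈ P', ∃ x ∈ P, ∀ j ∈ J, c x j = c y j) :
    StronglyKoszulOn c P' J ↔ StronglyKoszulOn c P J := by
  classical
  choose! g hg hgc using h
  have hj : ∀ j ∈ J, ∀ y ∈ P', c y j = c (if y ∈ P then y else g y) j := by
    intro j hj y hy
    split_ifs with h
    exacts [rfl, (hgc y hy j hj).symm]
  refine stronglyKoszulOn_transfer (fun y => if y ∈ P then y else g y) (fun y hy => ?_)
    (fun x hx => ⟨x, hP hx, if_pos hx⟩) (fun j hj' => Or.inr ⟨j, hj', hj j hj'⟩)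
    (fun j hj' => Or.inr ⟨j, hj', hj j hj'⟩)
  simp only
  split_ifs with h
  exacts [h, hg y hy]

theorem IsWord.exists_isCircuit_mem {w : Finset ι} (hw : IsWord C w) {e : ι} (he : e ∈ w) :
    ∃ w' ⊆ w, IsCircuit C w' ∧ e ∈ w' := by
  classical
  induction w using Finset.strongInduction with
  | H w ih =>
    by_cases hcirc : IsCircuit C w
    · exact ⟨w, subset_rfl, hcirc, he⟩
    · simp only [IsCircuit, not_and, not_forall] at hcirc
      obtain ⟨w', hw', hword, hne⟩ := hcirc hw ⟨e, he⟩
      push Not at hne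
      have hss : w' ⊂ w := hw'.ssubset_of_ne hne.2
      by_cases he' : e ∈ w'
      · obtain ⟨w'', h1, h2⟩ := ih w' hss hword he'
        exact ⟨w'', h1.trans hw', h2⟩
      · have hsd : _root_.symmDiff w w' = w \ w' := by
          rw [symmDiff_def, Finset.sup_eq_union, Finset.sdiff_eq_empty_iff_subset.2 hw',
            Finset.union_empty]
        obtain ⟨w'', h1, h2⟩ := ih (w \ w')
          (Finset.sdiff_ssubset hw' hne.1) (hsd ▸ hw.symmDiff hword)
          (Finset.mem_sdiff.2 ⟨he, he'⟩)
        exact ⟨w'', h1.trans Finset.sdiff_subset, h2⟩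

/-- On `J` the word `z` is supported at `f` alone, so the one-coordinate code at `f` is a direct
summand. -/
theorem codeSK_of_coloop {J : Set ι} {f : ι} (hf : f ∈ J) {z : ι → ZMod 2} (hz : z ∈ C)
    (hzf : z f = 1) (hz0 : ∀ i ∈ J \ {f}, z i = 0) (h : CodeSK (shorten {f} C) J) :
    CodeSK C J := by
  refine codeSK_of_directSum {f} (fun x hx => ⟨x f • z, C.smul_mem _ hz, ?_, fun i hi => ?_⟩) ?_ ?_
  · rintro i ⟨-, rfl⟩
    simp [hzf]
  · simp [hz0 i hi]
  · exact codeSK_of_single f fun x hx => hx.2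
  · rwa [Set.inter_eq_right.2 (Set.singleton_subset_iff.2 hf)]

/-- The coordinates of `C` in `J` are nonzero and pairwise distinct. -/
def IsSimpleOn (C : Submodule (ZMod 2) (ι → ZMod 2)) (J : Finset ι) : Prop :=
  ∀ w ⊆ J, IsWord C w → w.Nonempty → 3 ≤ w.card

theorem IsWord.pair {i j : ι} [DecidableEq ι] (hij : i ≠ j) (h : ∀ x ∈ C, x i = x j) :
    IsWord C {i, j} := fun x hx => by
  rw [Finset.sum_pair hij, h x hx, CharTwo.add_self_eq_zero]

/-- If every circuit through `e` is a triangle, then the code splits as the code of these triangles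
and the remaining coordinates. -/
theorem isWord_filter_of_triangles [DecidableEq ι] {J : Finset ι} {e : ι}
    (h3 : ∀ w ⊆ J, IsCircuit C w → e ∈ w → w.card = 3) (T : Set ι) [DecidablePred (· ∈ T)]
    (hT : ∀ i, i ∈ T ↔ i = e ∨ ∃ w ⊆ J, IsCircuit C w ∧ e ∈ w ∧ i ∈ w) {w : Finset ι}
    (hwJ : w ⊆ J) (hw : IsWord C w) : IsWord C (w.filter (· ∈ T)) := by
  induction hn : w.card using Nat.strong_induction_on generalizing w with
  | _ n ih =>
    have hfil : ∀ v t : Finset ι, (∀ i ∈ t, i ∈ T) →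
        (symmDiff v t).filter (· ∈ T) = symmDiff (v.filter (· ∈ T)) t := by
      intro v t ht
      ext i
      have := ht i
      simp only [Finset.mem_filter, Finset.mem_symmDiff]
      tauto
    have hback : ∀ v t : Finset ι, symmDiff (symmDiff v t) t = v := fun v t => by
      rw [symmDiff_assoc, symmDiff_self, Finset.bot_eq_empty]; exact symmDiff_bot v
    have hsub : ∀ v t : Finset ι, v ⊆ J → t ⊆ J → symmDiff v t ⊆ J := by
      intro v t hv ht i hi
      rcases Finset.mem_symmDiff.1 hi with h | h
      exacts [hv h.1, ht h.1]
    have hmem : ∀ t ⊆ J, IsCircuit C t → e ∈ t → ∀ i ∈ t, i ∈ T := fun t htJ ht het i hi =>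
      (hT i).2 (Or.inr ⟨t, htJ, ht, het, hi⟩)
    -- Removing a triangle inside `v` lowers the size by three and changes the part in `T` by a dual
    -- word.
    have hred : ∀ v ⊆ J, IsWord C v → e ∈ v → v.card < n + 3 →
        IsWord C (v.filter (· ∈ T)) := by
      intro v hvJ hv hev hcard
      obtain ⟨t, htv, htc, het⟩ := hv.exists_isCircuit_mem hev
      have ht3 := h3 t (htv.trans hvJ) htc het
      have hsd : (symmDiff v t).card < n := by
        rw [symmDiff_def, Finset.sup_eq_union, Finset.sdiff_eq_empty_iff_subset.2 htv,
            Finset.union_empty, Finset.card_sdiff_of_subset htv]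
        have := Finset.card_le_card htv
        omega
      have := ih _ hsd (hsub v t hvJ (htv.trans hvJ)) (hv.symmDiff htc.1) rfl
      rw [hfil v t (hmem t (htv.trans hvJ) htc het)] at this
      have := this.symmDiff htc.1
      rwa [hback] at this
    by_cases hew : e ∈ w
    · exact hred w hwJ hw hew (by omega)
    by_cases hex : ∃ i ∈ w, i ∈ T
    · obtain ⟨i, hiw, hiT⟩ := hex
      obtain ⟨t, htJ, ht, het, hit⟩ := ((hT i).1 hiT).resolve_left (by rintro rfl; exact hew hiw)
      -- The triangle meets `w` in `i`, so adding it brings in at most two new elements, one of them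
      -- `e`; the reduction in `hred` more than makes up for this.
      have hcard : (symmDiff w t).card < n + 3 := by
        rw [symmDiff_def, Finset.sup_eq_union]
        have h1 := Finset.card_union_le (w \ t) (t \ w)
        have h2 : (t \ w).card < t.card := Finset.card_lt_card
          (Finset.ssubset_iff_of_subset Finset.sdiff_subset |>.2 ⟨i, hit, by simp [hiw]⟩)
        have h3 := h3 t htJ ht het
        have h4 := Finset.card_le_card (Finset.sdiff_subset (s := w) (t := t))
        omega
      have := hred _ (hsub w t hwJ htJ) (hw.symmDiff ht.1)
        (Finset.mem_symmDiff.2 (Or.inr ⟨het, hew⟩)) hcard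
      rw [hfil w t (hmem t htJ ht het)] at this
      have := this.symmDiff ht.1
      rwa [hback] at this
    · rw [Finset.filter_false_of_mem (fun i hi hiT => hex ⟨i, hi, hiT⟩)]
      exact isWord_empty C

/-- `T` consists of `e` and the triangles `{e, f w, g w}` through it, and splits off by
`isWord_filter_of_triangles`. Since `g w = f w + e` on the code, with `e` and the `f w` independent,
the part in `T` without `e` is the cut code of `K_{2,I}`, where `I` is the set of triangles. -/
theorem codeSK_erase_of_triangles [DecidableEq ι] {J : Finset ι} {e : ι} (heJ : e ∈ J)
    (hs : IsSimpleOn C J) (h3 : ∀ w ⊆ J, IsCircuit C w → e ∈ w → w.card = 3)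
    (hC : CodeSK C (J : Set ι)) : CodeSK C ((J.erase e : Finset ι) : Set ι) := by
  classical
  set T : Set ι := {i | i = e ∨ ∃ w ⊆ J, IsCircuit C w ∧ e ∈ w ∧ i ∈ w} with hTdef
  have hT : ∀ i, i ∈ T ↔ i = e ∨ ∃ w ⊆ J, IsCircuit C w ∧ e ∈ w ∧ i ∈ w := fun i => Iff.rfl
  have heT : e ∈ T := Or.inl rfl
  have hTJ : T ⊆ J := by
    rintro i (rfl | ⟨w, hw, -, -, hi⟩)
    exacts [heJ, hw hi]
  -- the projection to the triangles
  have proj : ∀ x ∈ C, ∃ y ∈ C, (∀ i ∈ T, y i = x i) ∧ ∀ i ∈ J, i ∉ T → y i = 0 := by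
    intro x hx
    obtain ⟨y, hy, hyt⟩ := exists_mem_eqOn_of_dual C J (fun i => if i ∈ T then x i else 0) (by
      intro w hwJ hw
      rw [← Finset.sum_filter]
      exact isWord_filter_of_triangles h3 T hT hwJ hw x hx)
    exact ⟨y, hy, fun i hi => by rw [hyt i (hTJ hi), if_pos hi],
      fun i hi hiT => by rw [hyt i hi, if_neg hiT]⟩
  -- the triangles
  let I := {w : Finset ι // w ⊆ J ∧ IsCircuit C w ∧ e ∈ w}
  have hpair : ∀ w : I, ∃ f g, f ≠ g ∧ w.1.erase e = {f, g} := fun w =>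
    Finset.card_eq_two.1 (by
      rw [Finset.card_erase_of_mem w.2.2.2, h3 _ w.2.1 w.2.2.1 w.2.2.2])
  choose f g hfg hw using hpair
  have hfw : ∀ w : I, f w ≠ e ∧ f w ∈ w.1 := fun w =>
    Finset.mem_erase.1 (by rw [hw w]; simp)
  have hgw : ∀ w : I, g w ≠ e ∧ g w ∈ w.1 := fun w =>
    Finset.mem_erase.1 (by rw [hw w]; simp)
  have hfJ : ∀ w : I, f w ∈ J := fun w => w.2.1 (hfw w).2
  have hgJ : ∀ w : I, g w ∈ J := fun w => w.2.1 (hgw w).2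
  have hfT : ∀ w : I, f w ∈ T := fun w => Or.inr ⟨w.1, w.2.1, w.2.2.1, w.2.2.2, (hfw w).2⟩
  have hgT : ∀ w : I, g w ∈ T := fun w => Or.inr ⟨w.1, w.2.1, w.2.2.1, w.2.2.2, (hgw w).2⟩
  have hmem : ∀ w : I, ∀ i, i ∈ w.1 ↔ i = e ∨ i = f w ∨ i = g w := by
    intro w i
    rw [← Finset.insert_erase w.2.2.2, hw w]
    simp
  have hrel : ∀ w : I, ∀ x ∈ C, x (g w) = x (f w) + x e := by
    intro w x hx
    have := w.2.2.1.1 x hx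
    rw [← Finset.insert_erase w.2.2.2, hw w, Finset.sum_insert (by
      simp [(hfw w).1.symm, (hgw w).1.symm]), Finset.sum_pair (hfg w)] at this
    grind
  -- Two triangles sharing another element besides `e` would differ in at most two elements, against
  -- simplicity.
  have huniq : ∀ w w' : I, ∀ i, i ≠ e → i ∈ w.1 → i ∈ w'.1 → w = w' := by
    intro w w' i hi hiw hiw'
    by_contra hne
    have hsub : symmDiff w.1 w'.1 ⊆ J := by
      intro i hi
      rcases Finset.mem_symmDiff.1 hi with h | h
      exacts [w.2.1 h.1, w'.2.1 h.1]
    have h1 := hs _ hsub (w.2.2.1.1.symmDiff w'.2.2.1.1) (by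
      rw [Finset.nonempty_iff_ne_empty]
      intro h0
      exact hne (Subtype.ext (symmDiff_eq_bot.1 h0)))
    have hint : ({e, i} : Finset ι) ⊆ w.1 ∩ w'.1 := by
      intro j hj
      simp only [Finset.mem_insert, Finset.mem_singleton] at hj
      rcases hj with rfl | rfl
      exacts [Finset.mem_inter.2 ⟨w.2.2.2, w'.2.2.2⟩, Finset.mem_inter.2 ⟨hiw, hiw'⟩]
    have h2 := Finset.card_le_card hint
    rw [Finset.card_pair hi.symm] at h2
    rw [symmDiff_def, Finset.sup_eq_union] at h1
    have h4 := Finset.card_union_le (w.1 \ w'.1) (w'.1 \ w.1)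
    have h5 := Finset.card_sdiff_add_card_inter w.1 w'.1
    have h6 := Finset.card_sdiff_add_card_inter w'.1 w.1
    rw [Finset.inter_comm] at h6
    have h7 := h3 _ w.2.1 w.2.2.1 w.2.2.2
    have h8 := h3 _ w'.2.1 w'.2.2.1 w'.2.2.2
    omega
  have hfg' : ∀ w w' : I, f w ≠ g w' := by
    intro w w' h
    obtain rfl := huniq w w' (f w) (hfw w).1 (hfw w).2 (h ▸ (hgw w').2)
    exact hfg w h
  refine codeSK_of_directSum T (fun x hx => ?_) ?_ ?_
  · obtain ⟨y, hy, hyT, hy0⟩ := proj x hx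
    exact ⟨y, hy, fun i hi => hyT i hi.2, fun i hi => hy0 i (Finset.mem_of_mem_erase hi.1) hi.2⟩
  · refine (stronglyKoszulOn_transfer (c' := twinVec) (P' := Set.univ) (J' := Set.univ)
      (fun x => (x e, fun w : I => x (f w))) (fun _ _ => trivial) ?_ ?_ ?_).2
      stronglyKoszulOn_twinVec
    -- Surjectivity is the independence of `e` and the `f w`. A dual word among them avoids `e`,
    -- since a circuit through `e` contains some `g w`. If it contained `f w`, adding the triangle
    -- `w` would give a word whose circuit through `e` is again `w`, although `f w` has cancelled.
    · rintro ⟨ε, φ⟩ -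
      let h : Option I → ι := fun o => o.elim e f
      have : Finite I := Finite.of_injective (β := {w // w ∈ J.powerset})
        (fun w => ⟨w.1, Finset.mem_powerset.2 w.2.1⟩) (fun w w' h => Subtype.ext (by simpa using h))
      have hinj : Function.Injective h := by
        rintro (_ | w) (_ | w') hww
        · rfl
        · exact ((hfw w').1 hww.symm).elim
        · exact ((hfw w).1 hww).elim
        · exact congrArg some (huniq w w' (f w) (hfw w).1 (hfw w).2
            (by rw [show f w = f w' from hww]; exact (hfw w').2))
      obtain ⟨x, hx, hxt⟩ := exists_mem_eq_of_dual C h (fun o => o.elim ε φ) (by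
        intro s hs'
        suffices s.map ⟨h, hinj⟩ = ∅ by
          rw [Finset.map_eq_empty] at this
          simp [this]
        have hword : IsWord C (s.map ⟨h, hinj⟩) := fun x hx => by simpa using hs' x hx
        have hsJ : s.map ⟨h, hinj⟩ ⊆ J := by
          intro i hi
          obtain ⟨_ | w, _, rfl⟩ := Finset.mem_map.1 hi
          exacts [heJ, hfJ w]
        have hng : ∀ w : I, g w ∉ s.map ⟨h, hinj⟩ := by
          intro w hi
          obtain ⟨_ | w', _, hww⟩ := Finset.mem_map.1 hi
          exacts [(hgw w).1 hww.symm, hfg' w' w hww]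
        have hne : e ∉ s.map ⟨h, hinj⟩ := by
          intro he
          obtain ⟨t, hts, htc, het⟩ := hword.exists_isCircuit_mem he
          exact hng ⟨t, hts.trans hsJ, htc, het⟩ (hts (hgw ⟨t, hts.trans hsJ, htc, het⟩).2)
        rw [Finset.eq_empty_iff_forall_notMem]
        intro i hi
        obtain ⟨w, rfl⟩ : ∃ w, i = f w := by
          obtain ⟨_ | w, _, rfl⟩ := Finset.mem_map.1 hi
          exacts [(hne hi).elim, ⟨w, rfl⟩]
        have hsub : symmDiff (s.map ⟨h, hinj⟩) w.1 ⊆ J := by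
          intro i hi
          rcases Finset.mem_symmDiff.1 hi with h | h
          exacts [hsJ h.1, w.2.1 h.1]
        obtain ⟨t, hts, htc, het⟩ := (hword.symmDiff w.2.2.1.1).exists_isCircuit_mem
          (Finset.mem_symmDiff.2 (Or.inr ⟨w.2.2.2, hne⟩))
        let t' : I := ⟨t, hts.trans hsub, htc, het⟩
        have hg' : g t' ∈ w.1 := by
          rcases Finset.mem_symmDiff.1 (hts (hgw t').2) with h | h
          exacts [(hng _ h.1).elim, h.1]
        have heq : t' = w := huniq t' w _ (hgw t').1 (hgw t').2 hg'
        have hft : f w ∈ t'.1 := by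
          have : ∀ v : I, v = w → f w ∈ v.1 := by
            rintro v rfl
            exact (hfw v).2
          exact this t' heq
        rcases Finset.mem_symmDiff.1 (hts hft) with h | h
        exacts [h.2 (hfw w).2, h.2 hi])
      obtain ⟨y, hy, hyT, hy0⟩ := proj x hx
      refine ⟨y, ⟨hy, fun i hi => hy0 i (Finset.mem_of_mem_erase hi.1) hi.2⟩, ?_⟩
      refine Prod.ext ?_ (funext fun w => ?_)
      · exact (hyT e heT).trans (hxt none)
      · exact (hyT (f w) (hfT w)).trans (hxt (some w))
    · intro j hj
      by_cases hjT : j ∈ T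
      · have hje := Finset.ne_of_mem_erase hj
        obtain ⟨t, htJ, ht, het, hjt⟩ := hjT.resolve_left hje
        rcases ((hmem ⟨t, htJ, ht, het⟩ j).1 hjt).resolve_left hje with h | h
        · exact Or.inr ⟨Sum.inl ⟨t, htJ, ht, het⟩, trivial, fun x hx => by simp [bits, twinVec, h]⟩
        · refine Or.inr ⟨Sum.inr ⟨t, htJ, ht, het⟩, trivial, fun x hx => ?_⟩
          simp [bits, twinVec, h, hrel _ x hx.1]
      · exact Or.inl fun x hx => bits_eq_zero.2 (hx.2 j ⟨hj, hjT⟩)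
    · rintro (w | w) -
      · exact Or.inr ⟨f w, Finset.mem_erase.2 ⟨(hfw w).1, hfJ w⟩, fun x _ => rfl⟩
      · refine Or.inr ⟨g w, Finset.mem_erase.2 ⟨(hgw w).1, hgJ w⟩, fun x hx => ?_⟩
        simp [bits, twinVec, hrel _ x hx.1]
  · have h1 : CodeSK (shorten T C) ((J.erase e : Finset ι) : Set ι) := by
      refine (codeSK_congr_coords (fun j hj => ?_) (fun j hj => ?_)).1 (codeSK_shorten hC hTJ)
      · by_cases hje : j = e
        · exact Or.inl fun x hx => hje ▸ hx.2 e heT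
        · exact Or.inr ⟨j, Finset.mem_erase.2 ⟨hje, hj⟩, fun _ _ => rfl⟩
      · exact Or.inr ⟨j, Finset.mem_of_mem_erase hj, fun _ _ => rfl⟩
    -- Words that are zero on `T` except at `e` are still present; adding their projection to `T`
    -- kills the value at `e` and changes no remaining coordinate.
    refine (stronglyKoszulOn_of_subset (P := (shorten T C : Set (ι → ZMod 2)))
      (P' := (shorten (((J.erase e : Finset ι) : Set ι) ∩ T) C : Set (ι → ZMod 2)))
      (fun x hx => ⟨hx.1, fun i hi => hx.2 i hi.2⟩) (fun x hx => ?_)).2 h1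
    obtain ⟨y, hy, hyT, hy0⟩ := proj x hx.1
    refine ⟨x + y, ⟨C.add_mem hx.1 hy, fun i hi => ?_⟩, fun j hj => ?_⟩
    · rw [Pi.add_apply, hyT i hi, CharTwo.add_self_eq_zero]
    · by_cases hjT : j ∈ T
      · simp [bits, hyT j hjT, hx.2 j ⟨hj, hjT⟩]
      · simp [bits, hy0 j (Finset.mem_of_mem_erase hj) hjT]

end Deletion
-- Ears of a circuit with four elements
section Ears

variable {ι : Type*} {C : Submodule (ZMod 2) (ι → ZMod 2)} {J D : Finset ι}

theorem IsCircuit.eq_empty_of_ssubset {w : Finset ι} (hD : IsCircuit C D) (hw : IsWord C w)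
    (h : w ⊂ D) : w = ∅ :=
  (hD.2.2 w h.subset hw).resolve_right h.ne

/-- The pair `{a, b}` is one of `{e, x}`, `{e, y}`, `{x, y}`, and the three relations then identify
`p` with `n₂`, `q` with `n₁`, or `p` with `q`. -/
theorem not_isWord_crossing {e x y a b p q n₁ n₂ : ι} (hab : a ≠ b) (ha : a = e ∨ a = x ∨ a = y)
    (hb : b = e ∨ b = x ∨ b = y) (hv : ∀ v ∈ C, v n₁ + v n₂ + (v a + v b) = 0)
    (hv₁ : ∀ v ∈ C, v p + v n₁ + (v e + v x) = 0) (hv₂ : ∀ v ∈ C, v q + v n₂ + (v e + v y) = 0)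
    (h₁ : ¬ ∀ v ∈ C, v p = v n₂) (h₂ : ¬ ∀ v ∈ C, v q = v n₁) (h₃ : ¬ ∀ v ∈ C, v p = v q) :
    False := by
  have c₁ : (∀ v ∈ C, v a + v b = v e + v x) → False := fun h => h₁ fun v hvC => by
    have h1 := hv v hvC
    have h2 := hv₁ v hvC
    rw [h v hvC] at h1
    clear * - h1 h2
    grind
  have c₂ : (∀ v ∈ C, v a + v b = v e + v y) → False := fun h => h₂ fun v hvC => by
    have h1 := hv v hvC
    have h2 := hv₂ v hvC
    rw [h v hvC] at h1
    clear * - h1 h2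
    grind
  have c₃ : (∀ v ∈ C, v a + v b = v x + v y) → False := fun h => h₃ fun v hvC => by
    have h1 := hv v hvC
    have h2 := hv₁ v hvC
    have h3 := hv₂ v hvC
    rw [h v hvC] at h1
    clear * - h1 h2 h3
    grind
  rcases ha with rfl | rfl | rfl <;> rcases hb with rfl | rfl | rfl <;>
    first
      | exact hab rfl
      | exact c₁ fun v _ => rfl
      | exact c₁ fun v _ => add_comm _ _
      | exact c₂ fun v _ => rfl
      | exact c₂ fun v _ => add_comm _ _
      | exact c₃ fun v _ => rfl
      | exact c₃ fun v _ => add_comm _ _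

variable [DecidableEq ι]

/-- `N` is a minimal nonempty set of the form `w \ D`, with `w` a dual word in `J`. -/
structure IsEar (C : Submodule (ZMod 2) (ι → ZMod 2)) (J D N : Finset ι) : Prop where
  nonempty : N.Nonempty
  subset : N ⊆ J
  disjoint : Disjoint N D
  minimal : ∀ w ⊆ J, IsWord C w → w \ D ⊆ N → w \ D = ∅ ∨ w \ D = N

theorem symmDiff_sdiff_right (w w' D : Finset ι) :
    symmDiff w w' \ D = symmDiff (w \ D) (w' \ D) := by
  ext i
  simp only [Finset.mem_sdiff, Finset.mem_symmDiff]
  tauto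

theorem symmDiff_subset {w w' : Finset ι} (hw : w ⊆ J) (hw' : w' ⊆ J) : symmDiff w w' ⊆ J := by
  intro i hi
  rcases Finset.mem_symmDiff.1 hi with h | h
  exacts [hw h.1, hw' h.1]

/-- A subword of `w` has outside part empty or `N`; correspondingly it, or its difference from `w`,
is a dual word strictly inside `D`, hence empty. -/
theorem IsEar.isCircuit {N w : Finset ι} (hN : IsEar C J D N) (hD : IsCircuit C D) (hwJ : w ⊆ J)
    (hw : IsWord C w) (hwN : w \ D = N) (hX : ¬ D ⊆ w) : IsCircuit C w := by
  have hss : ∀ v, v ⊆ w → v ⊆ D → v ⊂ D := fun v hvw hvD =>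
    hvD.ssubset_of_ne (by rintro rfl; exact hX hvw)
  refine ⟨hw, ?_, fun w' hw' hword => ?_⟩
  · obtain ⟨i, hi⟩ := hN.nonempty
    rw [← hwN] at hi
    exact ⟨i, (Finset.mem_sdiff.1 hi).1⟩
  · rcases hN.minimal w' (hw'.trans hwJ) hword
      (hwN ▸ Finset.sdiff_subset_sdiff hw' subset_rfl) with h | h
    · exact Or.inl (hD.eq_empty_of_ssubset hword (hss _ hw' (Finset.sdiff_eq_empty_iff_subset.1 h)))
    · right
      have h0 : symmDiff w' w \ D = ∅ := by
        rw [symmDiff_sdiff_right, h, hwN, symmDiff_self]; rfl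
      refine symmDiff_eq_bot.1 (hD.eq_empty_of_ssubset (hword.symmDiff hw) (hss _ ?_
        (Finset.sdiff_eq_empty_iff_subset.1 h0)))
      exact symmDiff_subset hw' subset_rfl

/-- `w` and `w ∆ D` are both circuits with outside part `N`, and they divide the four elements of
`D` between them. Both have three or four elements, which rules out a division into one and three.
-/
theorem IsEar.card_inter (hs : IsSimpleOn C J) (h4 : ∀ w ⊆ J, IsCircuit C w → w.card ≤ 4)
    {N w : Finset ι} (hN : IsEar C J D N) (hD : IsCircuit C D) (hDJ : D ⊆ J) (hDc : D.card = 4)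
    (hwJ : w ⊆ J) (hw : IsWord C w) (hwN : w \ D = N) (hX : ¬ D ⊆ w) (hX0 : (w ∩ D).Nonempty) :
    (w ∩ D).card = 2 ∧ N.card ≤ 2 := by
  have hw' : symmDiff w D \ D = N := by
    rw [symmDiff_sdiff_right, hwN, Finset.sdiff_self]
    exact symmDiff_bot N
  have hwD : symmDiff w D ∩ D = D \ w := by
    ext i
    simp only [Finset.mem_inter, Finset.mem_symmDiff, Finset.mem_sdiff]
    tauto
  have hX' : ¬ D ⊆ symmDiff w D := by
    obtain ⟨i, hi⟩ := hX0
    intro h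
    have := h (Finset.mem_inter.1 hi).2
    rw [Finset.mem_symmDiff] at this
    have := Finset.mem_inter.1 hi
    tauto
  have hJ' := symmDiff_subset hwJ hDJ
  have c1 := h4 w hwJ (hN.isCircuit hD hwJ hw hwN hX)
  have hcirc := hN.isCircuit hD hJ' (hw.symmDiff hD.1) hw' hX'
  have c2 := h4 _ hJ' hcirc
  have c3 := hs w hwJ hw (hN.isCircuit hD hwJ hw hwN hX).2.1
  have c4 := hs _ hJ' hcirc.1 hcirc.2.1
  have e1 := Finset.card_sdiff_add_card_inter w D
  have e2 := Finset.card_sdiff_add_card_inter (symmDiff w D) D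
  have e3 := Finset.card_sdiff_add_card_inter D w
  have p1 := Finset.card_pos.2 hX0
  have p2 := Finset.card_pos.2 (Finset.sdiff_nonempty.2 hX)
  rw [hwN] at e1
  rw [hw', hwD] at e2
  rw [Finset.inter_comm] at e3
  omega

/-- Two ears at different pairs of elements of a circuit with four elements give `K₄`. -/
theorem not_codeSK_of_two_ears (hC : CodeSK C (J : Set ι)) (hNF : NoFano C) (hs : IsSimpleOn C J)
    (h4 : ∀ w ⊆ J, IsCircuit C w → w.card ≤ 4) (hD : IsCircuit C D) (hDJ : D ⊆ J)
    (hDc : D.card = 4) {e x y z : ι} (hDe : D = {e, x, y, z}) (hex : e ≠ x) (hey : e ≠ y)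
    (hez : e ≠ z) (hxy : x ≠ y) (hxz : x ≠ z) (hyz : y ≠ z) {N₁ N₂ : Finset ι}
    (h₁ : IsEar C J D N₁) (h₂ : IsEar C J D N₂) (hw₁ : IsWord C (N₁ ∪ {e, x}))
    (hw₂ : IsWord C (N₂ ∪ {e, y})) : False := by
  have heD : e ∈ D := by simp [hDe]
  have hxD : x ∈ D := by simp [hDe]
  have hyD : y ∈ D := by simp [hDe]
  have hzD : z ∈ D := by simp [hDe]
  have hd₁ : ∀ i ∈ N₁, i ∉ D := fun i hi => Finset.disjoint_left.1 h₁.disjoint hi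
  have hd₂ : ∀ i ∈ N₂, i ∉ D := fun i hi => Finset.disjoint_left.1 h₂.disjoint hi
  have hpairJ : ∀ i ∈ D, ∀ j ∈ D, ({i, j} : Finset ι) ⊆ J := by
    intro i hi j hj k hk
    simp only [Finset.mem_insert, Finset.mem_singleton] at hk
    rcases hk with rfl | rfl
    exacts [hDJ hi, hDJ hj]
  have hJ₁ : N₁ ∪ {e, x} ⊆ J := Finset.union_subset h₁.subset (hpairJ e heD x hxD)
  have hJ₂ : N₂ ∪ {e, y} ⊆ J := Finset.union_subset h₂.subset (hpairJ e heD y hyD)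
  have hs2 : ∀ i ∈ J, ∀ j ∈ J, ¬ IsWord C ({i, j} : Finset ι) := by
    intro i hi j hj h
    have := hs _ (by
      intro k hk
      simp only [Finset.mem_insert, Finset.mem_singleton] at hk
      rcases hk with rfl | rfl
      exacts [hi, hj]) h ⟨i, by simp⟩
    have := Finset.card_le_two (a := i) (b := j)
    omega
  have hsd : ∀ (N : Finset ι) (j : ι), (∀ i ∈ N, i ∉ D) → j ∈ D → (N ∪ {e, j}) \ D = N := by
    intro N j hN hj
    ext i
    have := hN i
    simp only [Finset.mem_sdiff, Finset.mem_union, Finset.mem_insert, Finset.mem_singleton]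
    constructor
    · rintro ⟨h | rfl | rfl, h'⟩
      exacts [h, (h' heD).elim, (h' hj).elim]
    · intro h
      exact ⟨Or.inl h, this h⟩
  have hsd₁ := hsd N₁ x hd₁ hxD
  have hsd₂ := hsd N₂ y hd₂ hyD
  have hsum : ∀ (N : Finset ι) (j : ι), (∀ i ∈ N, i ∉ D) → j ∈ D → e ≠ j → ∀ v : ι → ZMod 2,
      ∑ i ∈ N ∪ {e, j}, v i = ∑ i ∈ N, v i + (v e + v j) := by
    intro N j hN hj hej v
    rw [Finset.sum_union (Finset.disjoint_left.2 fun i hi hi' => by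
      simp only [Finset.mem_insert, Finset.mem_singleton] at hi'
      rcases hi' with rfl | rfl
      exacts [hN _ hi heD, hN _ hi hj]), Finset.sum_pair hej]
  have hne : N₁ ≠ N₂ := by
    rintro rfl
    refine hs2 x (hDJ hxD) y (hDJ hyD) ?_
    refine IsWord.pair hxy fun v hv => ?_
    have h1 := hw₁ v hv
    have h2 := hw₂ v hv
    rw [hsum N₁ x hd₁ hxD hex] at h1
    rw [hsum N₁ y hd₁ hyD hey] at h2
    exact add_left_cancel (add_left_cancel (h1.trans h2.symm))
  have hn₁ : ¬ N₁ ⊆ N₂ := by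
    intro h
    rcases h₂.minimal _ hJ₁ hw₁ (hsd₁.symm ▸ h) with h' | h'
    · rw [hsd₁] at h'
      exact h₁.nonempty.ne_empty h'
    · exact hne (hsd₁.symm.trans h')
  have hn₂ : ¬ N₂ ⊆ N₁ := by
    intro h
    rcases h₁.minimal _ hJ₂ hw₂ (hsd₂.symm ▸ h) with h' | h'
    · rw [hsd₂] at h'
      exact h₂.nonempty.ne_empty h'
    · exact hne (hsd₂.symm.trans h').symm
  obtain ⟨p, hp₁, hp₂⟩ := Finset.not_subset.1 hn₁
  obtain ⟨q, hq₂, hq₁⟩ := Finset.not_subset.1 hn₂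
  have hzw : ∀ (N : Finset ι) (j : ι), (∀ i ∈ N, i ∉ D) → j ∈ D → j ≠ z → ¬ D ⊆ N ∪ {e, j} := by
    intro N j hN hj hjz h
    have := h hzD
    simp only [Finset.mem_union, Finset.mem_insert, Finset.mem_singleton] at this
    rcases this with h | h | h
    exacts [hN z h hzD, hez h.symm, hjz h.symm]
  have hc₁ := (h₁.card_inter hs h4 hD hDJ hDc hJ₁ hw₁ hsd₁ (hzw _ _ hd₁ hxD hxz)
    ⟨e, by simp [heD]⟩).2
  have hc₂ := (h₂.card_inter hs h4 hD hDJ hDc hJ₂ hw₂ hsd₂ (hzw _ _ hd₂ hyD hyz)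
    ⟨e, by simp [heD]⟩).2
  -- Shortening at `F` keeps one element of each ear, with `p = e + x`, `q = e + y` and `z = e + x +
  -- y`. This is `K₄` provided `e`, `x`, `y` stay independent, which follows from `hempty`.
  set F : Finset ι := (N₁ ∪ N₂) \ {p, q} with hF
  have hpF : p ∉ F := by simp [hF]
  have hqF : q ∉ F := by simp [hF]
  have hFJ : F ⊆ J := Finset.sdiff_subset.trans (Finset.union_subset h₁.subset h₂.subset)
  have hFD : ∀ i ∈ F, i ∉ D := by
    intro i hi
    rcases Finset.mem_union.1 (Finset.mem_sdiff.1 hi).1 with h | h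
    exacts [hd₁ i h, hd₂ i h]
  have hempty : ∀ w ⊆ F ∪ {e, x, y}, IsWord C w → w = ∅ := by
    intro w hwS hw
    have hwJ : w ⊆ J := by
      refine hwS.trans (Finset.union_subset hFJ ?_)
      intro k hk
      simp only [Finset.mem_insert, Finset.mem_singleton] at hk
      rcases hk with rfl | rfl | rfl
      exacts [hDJ heD, hDJ hxD, hDJ hyD]
    have hzw : z ∉ w := by
      intro h
      have := hwS h
      simp only [Finset.mem_union, Finset.mem_insert, Finset.mem_singleton] at this
      rcases this with h | h | h | h
      exacts [hFD z h hzD, hez h.symm, hxz h.symm, hyz h.symm]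
    have hXD : ¬ D ⊆ w := fun h => hzw (h hzD)
    have hwF : w \ D ⊆ F := by
      intro i hi
      obtain ⟨hi, hiD⟩ := Finset.mem_sdiff.1 hi
      have := hwS hi
      simp only [Finset.mem_union, Finset.mem_insert, Finset.mem_singleton] at this
      rcases this with h | rfl | rfl | rfl
      exacts [h, (hiD heD).elim, (hiD hxD).elim, (hiD hyD).elim]
    have hdone : w \ D = ∅ → w = ∅ := fun h => hD.eq_empty_of_ssubset hw
      ((Finset.sdiff_eq_empty_iff_subset.1 h).ssubset_of_ne (by rintro rfl; exact hXD subset_rfl))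
    by_cases hwN₁ : w \ D ⊆ N₁
    · exact hdone ((h₁.minimal w hwJ hw hwN₁).resolve_right fun h => hpF (hwF (h ▸ hp₁)))
    by_cases hwN₂ : w \ D ⊆ N₂
    · exact hdone ((h₂.minimal w hwJ hw hwN₂).resolve_right fun h => hqF (hwF (h ▸ hq₂)))
    -- The word now contains an element of each ear outside the other. As ears have at most two
    -- elements, `N₁ = {p, n₁}` and `N₂ = {q, n₂}`, so `{n₁, n₂}` is an ear crossing both, and some
    -- two coordinates would be parallel.
    exfalso
    obtain ⟨n₂, hn₂w, hn₂₁⟩ := Finset.not_subset.1 hwN₁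
    obtain ⟨n₁, hn₁w, hn₁₂⟩ := Finset.not_subset.1 hwN₂
    have hn₁F := hwF hn₁w
    have hn₂F := hwF hn₂w
    have hn₁p : n₁ ≠ p := by rintro rfl; exact hpF hn₁F
    have hn₂q : n₂ ≠ q := by rintro rfl; exact hqF hn₂F
    have hn₁₁ : n₁ ∈ N₁ := (Finset.mem_union.1 (Finset.mem_sdiff.1 hn₁F).1).resolve_right hn₁₂
    have hn₂₂ : n₂ ∈ N₂ := (Finset.mem_union.1 (Finset.mem_sdiff.1 hn₂F).1).resolve_left hn₂₁
    have hN₁ : N₁ = {p, n₁} := (Finset.eq_of_subset_of_card_le (by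
      intro k hk
      simp only [Finset.mem_insert, Finset.mem_singleton] at hk
      rcases hk with rfl | rfl <;> assumption) (by rwa [Finset.card_pair hn₁p.symm])).symm
    have hN₂ : N₂ = {q, n₂} := (Finset.eq_of_subset_of_card_le (by
      intro k hk
      simp only [Finset.mem_insert, Finset.mem_singleton] at hk
      rcases hk with rfl | rfl <;> assumption) (by rwa [Finset.card_pair hn₂q.symm])).symm
    have hN12 : n₁ ≠ n₂ := by rintro rfl; exact hn₁₂ hn₂₂
    have hFeq : ∀ i, i ∈ F → i = n₁ ∨ i = n₂ := by
      intro i hi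
      rw [hF, hN₁, hN₂] at hi
      simp only [Finset.mem_sdiff, Finset.mem_union, Finset.mem_insert, Finset.mem_singleton] at hi
      tauto
    have hwD : w \ D = {n₁, n₂} := by
      ext i
      simp only [Finset.mem_insert, Finset.mem_singleton]
      constructor
      · exact fun h => hFeq i (hwF h)
      · rintro (rfl | rfl) <;> assumption
    have hpJ : p ∈ J := h₁.subset hp₁
    have hqJ : q ∈ J := h₂.subset hq₂
    have hn₁J : n₁ ∈ J := h₁.subset hn₁₁
    have hn₂J : n₂ ∈ J := h₂.subset hn₂₂
    have hpD := hd₁ p hp₁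
    have hqD := hd₂ q hq₂
    have hn₁D := hd₁ n₁ hn₁₁
    have hn₂D := hd₂ n₂ hn₂₂
    have hear : IsEar C J D {n₁, n₂} := by
      refine ⟨⟨n₁, by simp⟩, ?_, ?_, fun w' hw'J hw' hsub => ?_⟩
      · intro k hk
        simp only [Finset.mem_insert, Finset.mem_singleton] at hk
        rcases hk with rfl | rfl <;> assumption
      · rw [← hwD]
        exact Finset.sdiff_disjoint
      · by_cases k1 : n₁ ∈ w' \ D
        · by_cases k2 : n₂ ∈ w' \ D
          · right
            refine hsub.antisymm ?_
            intro k hk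
            simp only [Finset.mem_insert, Finset.mem_singleton] at hk
            rcases hk with rfl | rfl <;> assumption
          · left
            refine (h₁.minimal w' hw'J hw' fun i hi => ?_).resolve_right fun h => ?_
            · have := hsub hi
              simp only [Finset.mem_insert, Finset.mem_singleton] at this
              rcases this with rfl | rfl
              exacts [hn₁₁, (k2 hi).elim]
            · have := hsub (h ▸ hp₁)
              simp only [Finset.mem_insert, Finset.mem_singleton] at this
              rcases this with rfl | rfl
              exacts [hn₁p rfl, hp₂ hn₂₂]
        · left
          refine (h₂.minimal w' hw'J hw' fun i hi => ?_).resolve_right fun h => ?_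
          · have := hsub hi
            simp only [Finset.mem_insert, Finset.mem_singleton] at this
            rcases this with rfl | rfl
            exacts [(k1 hi).elim, hn₂₂]
          · have := hsub (h ▸ hq₂)
            simp only [Finset.mem_insert, Finset.mem_singleton] at this
            rcases this with rfl | rfl
            exacts [hq₁ hn₁₁, hn₂q rfl]
    rcases (w ∩ D).eq_empty_or_nonempty with h0 | h0
    · refine hs2 n₁ hn₁J n₂ hn₂J ?_
      rwa [← hwD, Finset.sdiff_eq_self_of_disjoint (Finset.disjoint_iff_inter_eq_empty.2 h0)]
    · have h2 := (hear.card_inter hs h4 hD hDJ hDc hwJ hw hwD hXD h0).1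
      have hwDs : ∀ i, i ∈ w ∩ D → i = e ∨ i = x ∨ i = y := by
        intro i hi
        have h1 := Finset.mem_inter.1 hi
        rw [hDe] at h1
        simp only [Finset.mem_insert, Finset.mem_singleton] at h1
        rcases h1.2 with h | h | h | h
        exacts [Or.inl h, Or.inr (Or.inl h), Or.inr (Or.inr h), (hzw (h ▸ h1.1)).elim]
      have hpn₂ : p ≠ n₂ := by rintro rfl; exact hp₂ hn₂₂
      have hqn₁ : q ≠ n₁ := by rintro rfl; exact hq₁ hn₁₁
      have hpq : p ≠ q := by rintro rfl; exact hp₂ hq₂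
      obtain ⟨a, b, hab, hX⟩ := Finset.card_eq_two.1 h2
      have ha := hwDs a (by rw [hX]; simp)
      have hb := hwDs b (by rw [hX]; simp)
      have hv : ∀ v ∈ C, v n₁ + v n₂ + (v a + v b) = 0 := by
        intro v hv
        have := hw v hv
        rwa [← Finset.sum_inter_add_sum_sdiff w D, hwD, hX, Finset.sum_pair hab,
          Finset.sum_pair hN12, add_comm] at this
      have hv₁ : ∀ v ∈ C, v p + v n₁ + (v e + v x) = 0 := by
        intro v hv
        have := hsum N₁ x hd₁ hxD hex v
        rw [hw₁ v hv] at this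
        rw [this, hN₁, Finset.sum_pair hn₁p.symm]
      have hv₂ : ∀ v ∈ C, v q + v n₂ + (v e + v y) = 0 := by
        intro v hv
        have := hsum N₂ y hd₂ hyD hey v
        rw [hw₂ v hv] at this
        rw [this, hN₂, Finset.sum_pair hn₂q.symm]
      exact not_isWord_crossing hab ha hb hv hv₁ hv₂
        (fun h => hs2 p hpJ n₂ hn₂J (IsWord.pair hpn₂ h))
        (fun h => hs2 q hqJ n₁ hn₁J (IsWord.pair hqn₁ h))
        (fun h => hs2 p hpJ q hqJ (IsWord.pair hpq h))
  have hvec : ∀ t : ι → ZMod 2, (∀ i ∈ F, t i = 0) →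
      ∃ v ∈ shorten (F : Set ι) C, v e = t e ∧ v x = t x ∧ v y = t y := by
    intro t ht
    obtain ⟨v, hv, hvt⟩ := exists_mem_eqOn_of_dual C (F ∪ {e, x, y}) t (by
      intro w hw hword
      rw [hempty w hw hword, Finset.sum_empty])
    exact ⟨v, ⟨hv, fun i hi => by rw [hvt i (Finset.mem_union_left _ hi), ht i hi]⟩,
      hvt e (by simp), hvt x (by simp), hvt y (by simp)⟩
  have hsingle : ∀ d ∈ D, ∀ i ∈ F, (Pi.single d 1 : ι → ZMod 2) i = 0 := by
    intro d hd i hi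
    rw [Pi.single_apply, if_neg]
    rintro rfl
    exact hFD _ hi hd
  have hrel : ∀ (N : Finset ι) (j r : ι), IsWord C (N ∪ {e, j}) → (∀ i ∈ N, i ∉ D) → j ∈ D →
      e ≠ j → r ∈ N → (∀ i ∈ N, i ≠ r → i ∈ F) → ∀ v ∈ shorten (F : Set ι) C,
      v r = v e + v j := by
    intro N j r hword hN hj hej hr hNF v hv
    have h := hword v hv.1
    rw [hsum N j hN hj hej, Finset.sum_eq_single_of_mem r hr
      (fun i hi hir => hv.2 i (hNF i hi hir))] at h
    exact CharTwo.add_eq_zero.1 h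
  obtain ⟨v₁, hv₁, a1, a2, a3⟩ := hvec (Pi.single e 1) (hsingle e heD)
  obtain ⟨v₂, hv₂, b1, b2, b3⟩ := hvec (Pi.single x 1) (hsingle x hxD)
  obtain ⟨v₃, hv₃, c1, c2, c3⟩ := hvec (Pi.single y 1) (hsingle y hyD)
  refine not_codeSK_of_completeGraph_four (e := e) (a := x) (b := y) (c := z) (p := p) (q := q)
    J.finite_toSet (codeSK_shorten (F := (F : Set ι)) hC hFJ) (hNF.shorten F) (hDJ heD)
    (hDJ hxD) (hDJ hyD) (hDJ hzD) (h₁.subset hp₁) (h₂.subset hq₂) (fun v hv => ?_)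
    (hrel N₁ x p hw₁ hd₁ hxD hex hp₁ fun i hi hip => ?_)
    (hrel N₂ y q hw₂ hd₂ hyD hey hq₂ fun i hi hiq => ?_)
    ⟨v₁, hv₁, ?_, ?_, ?_⟩ ⟨v₂, hv₂, ?_, ?_, ?_⟩ ⟨v₃, hv₃, ?_, ?_, ?_⟩
  · have h := hD.1 v hv.1
    rw [hDe, Finset.sum_insert (by simp [hex, hey, hez]), Finset.sum_insert (by simp [hxy, hxz]),
      Finset.sum_pair hyz] at h
    grind
  · refine Finset.mem_sdiff.2 ⟨Finset.mem_union_left _ hi, ?_⟩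
    simp only [Finset.mem_insert, Finset.mem_singleton, not_or]
    exact ⟨hip, by rintro rfl; exact hq₁ hi⟩
  · refine Finset.mem_sdiff.2 ⟨Finset.mem_union_right _ hi, ?_⟩
    simp only [Finset.mem_insert, Finset.mem_singleton, not_or]
    exact ⟨by rintro rfl; exact hp₂ hi, hiq⟩
  · rw [a1]; simp
  · rw [a2]; simp [hex.symm]
  · rw [a3]; simp [hey.symm]
  · rw [b1]; simp [hex]
  · rw [b2]; simp
  · rw [b3]; simp [hxy.symm]
  · rw [c1]; simp [hey]
  · rw [c2]; simp [hxy]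
  · rw [c3]; simp

/-- If `e` and `f` are elements of a circuit `D` that are not in series, some ear of `D` separates
them. -/
theorem exists_isEar_separating (hD : IsCircuit C D) (hDJ : D ⊆ J) {e f : ι}
    (heD : e ∈ D) (hfD : f ∈ D) {w₀ : Finset ι} (hw₀J : w₀ ⊆ J) (hw₀ : IsWord C w₀)
    (hef : ¬ (e ∈ w₀ ↔ f ∈ w₀)) :
    ∃ w ⊆ J, IsWord C w ∧ IsEar C J D (w \ D) ∧ e ∈ w ∧ f ∉ w := by
  classical
  set S := J.powerset.filter fun w => IsWord C w ∧ ¬ (e ∈ w ↔ f ∈ w) with hS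
  have hmemS : ∀ w, w ∈ S ↔ w ⊆ J ∧ IsWord C w ∧ ¬ (e ∈ w ↔ f ∈ w) := fun w => by
    rw [hS, Finset.mem_filter, Finset.mem_powerset]
  -- Take a separating word with fewest elements outside `D`. If `w'` had a smaller nonempty outside
  -- part within that of `w`, then `w'` or `w ∆ w'` would still separate and contradict minimality.
  obtain ⟨w, hwS, hmin⟩ := Finset.exists_min_image S (fun w => (w \ D).card)
    ⟨w₀, (hmemS w₀).2 ⟨hw₀J, hw₀, hef⟩⟩
  obtain ⟨hwJ, hw, hsep⟩ := (hmemS w).1 hwS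
  have hear : IsEar C J D (w \ D) := by
    refine ⟨Finset.nonempty_iff_ne_empty.2 fun h0 => ?_, Finset.sdiff_subset.trans hwJ,
      Finset.sdiff_disjoint, fun w' hw'J hw' hsub => ?_⟩
    · rcases hD.2.2 w (Finset.sdiff_eq_empty_iff_subset.1 h0) hw with rfl | rfl
      · simp at hsep
      · exact hsep (by simp [heD, hfD])
    · by_contra hcon
      push Not at hcon
      have hlt : (w' \ D).card < (w \ D).card :=
        Finset.card_lt_card (hsub.ssubset_of_ne hcon.2)
      by_cases hsep' : e ∈ w' ↔ f ∈ w'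
      · have h1 := hmin (symmDiff w w') ((hmemS _).2 ⟨symmDiff_subset hwJ hw'J, hw.symmDiff hw', by
          simp only [Finset.mem_symmDiff]
          tauto⟩)
        have h2 : (symmDiff w w' \ D).card < (w \ D).card := by
          refine Finset.card_lt_card ?_
          rw [symmDiff_sdiff_right, symmDiff_def, Finset.sup_eq_union,
            Finset.sdiff_eq_empty_iff_subset.2 hsub, Finset.union_empty]
          exact Finset.sdiff_ssubset hsub hcon.1
        omega
      · have h1 := hmin w' ((hmemS _).2 ⟨hw'J, hw', hsep'⟩)
        omega
  -- Adding `D` interchanges the roles of `e` and `f` and leaves the outside part unchanged.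
  by_cases he : e ∈ w
  · exact ⟨w, hwJ, hw, hear, he, by tauto⟩
  · have hsd : symmDiff w D \ D = w \ D := by
      rw [symmDiff_sdiff_right, Finset.sdiff_self]
      exact symmDiff_bot _
    refine ⟨symmDiff w D, symmDiff_subset hwJ hDJ, hw.symmDiff hD.1, hsd.symm ▸ hear, ?_, ?_⟩
    · exact Finset.mem_symmDiff.2 (Or.inr ⟨heD, he⟩)
    · rw [Finset.mem_symmDiff]
      tauto

end Ears
-- Series elements and the deletion of a coordinate
section DeletionTheorem

variable {ι : Type*} [DecidableEq ι] {C : Submodule (ZMod 2) (ι → ZMod 2)} {J D : Finset ι}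

/-- For an element `e` of a circuit with four elements in a strongly Koszul code, some other element
of the circuit is in series with `e`. -/
theorem exists_series (hC : CodeSK C (J : Set ι)) (hNF : NoFano C) (hs : IsSimpleOn C J)
    (hD : IsCircuit C D) (hDJ : D ⊆ J) (hDc : D.card = 4) {e : ι} (heD : e ∈ D) :
    ∃ f ∈ D, f ≠ e ∧ ∃ z ∈ C, z f = 1 ∧ ∀ i ∈ J, i ≠ e → i ≠ f → z i = 0 := by
  by_contra hcon
  push Not at hcon
  have h4 : ∀ w ⊆ J, IsCircuit C w → w.card ≤ 4 := fun w hw hwc =>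
    hwc.card_le_four J.finite_toSet hC hNF (by exact_mod_cast hw)
  have hear : ∀ f ∈ D, f ≠ e → ∃ g ∈ D, g ≠ e ∧ g ≠ f ∧
      ∃ N, IsEar C J D N ∧ IsWord C (N ∪ {e, g}) := by
    intro f hfD hfe
    -- If every dual word contained both or neither of `e` and `f`, duality would give a word that
    -- on `J` is one exactly at `e` and `f`, against `hcon`.
    obtain ⟨w₀, hw₀J, hw₀, hsep⟩ : ∃ w ⊆ J, IsWord C w ∧ ¬ (e ∈ w ↔ f ∈ w) := by
      by_contra hno
      push Not at hno
      obtain ⟨z, hz, hzt⟩ := exists_mem_eqOn_of_dual C J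
        (fun i => if i = e ∨ i = f then 1 else 0) (by
          intro w hwJ hw
          have := hno w hwJ hw
          rw [← Finset.sum_filter]
          by_cases he : e ∈ w
          · have : w.filter (fun i => i = e ∨ i = f) = {e, f} := by
              ext i
              simp only [Finset.mem_filter, Finset.mem_insert, Finset.mem_singleton]
              constructor
              · exact fun h => h.2
              · rintro (rfl | rfl)
                exacts [⟨he, Or.inl rfl⟩, ⟨this.1 he, Or.inr rfl⟩]
            rw [this, Finset.sum_pair hfe.symm]
            rfl
          · rw [Finset.filter_false_of_mem, Finset.sum_empty]
            rintro i hi (rfl | rfl)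
            exacts [he hi, he (this.2 hi)])
      obtain ⟨i, hiJ, hie, hif, hzi⟩ := hcon f hfD hfe z hz
        (by rw [hzt f (hDJ hfD)]; simp)
      exact hzi (by rw [hzt i hiJ]; simp [hie, hif])
    obtain ⟨w, hwJ, hw, hN, hew, hfw⟩ := exists_isEar_separating hD hDJ heD hfD hw₀J hw₀ hsep
    have h2 := (hN.card_inter hs h4 hD hDJ hDc hwJ hw rfl (fun h => hfw (h hfD))
      ⟨e, Finset.mem_inter.2 ⟨hew, heD⟩⟩).1
    obtain ⟨g, hg⟩ := Finset.card_eq_one.1 (show ((w ∩ D).erase e).card = 1 by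
      rw [Finset.card_erase_of_mem (Finset.mem_inter.2 ⟨hew, heD⟩), h2])
    have hge : g ∈ (w ∩ D).erase e := by rw [hg]; simp
    obtain ⟨hge, hgw⟩ := Finset.mem_erase.1 hge
    obtain ⟨hgw, hgD⟩ := Finset.mem_inter.1 hgw
    refine ⟨g, hgD, hge, by rintro rfl; exact hfw hgw, w \ D, hN, ?_⟩
    rw [← hg, Finset.insert_erase (Finset.mem_inter.2 ⟨hew, heD⟩), Finset.sdiff_union_inter]
    exact hw
  obtain ⟨a, b, c, hab, hac, hbc, hDe⟩ := Finset.card_eq_three.1 (show (D.erase e).card = 3 by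
    rw [Finset.card_erase_of_mem heD, hDc])
  have hDe' : D = {e, a, b, c} := by rw [← hDe, Finset.insert_erase heD]
  have hae : a ≠ e ∧ a ∈ D := Finset.mem_erase.1 (by rw [hDe]; simp)
  have hbe : b ≠ e ∧ b ∈ D := Finset.mem_erase.1 (by rw [hDe]; simp)
  have hce : c ≠ e ∧ c ∈ D := Finset.mem_erase.1 (by rw [hDe]; simp)
  have hcase : ∀ g ∈ D, g ≠ e → g = a ∨ g = b ∨ g = c := by
    intro g hg hge
    have : g ∈ D.erase e := Finset.mem_erase.2 ⟨hge, hg⟩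
    rw [hDe] at this
    simpa using this
  have htwo : ∀ x ∈ D, ∀ y ∈ D, x ≠ e → y ≠ e → x ≠ y →
      (∃ N, IsEar C J D N ∧ IsWord C (N ∪ {e, x})) →
      ¬ ∃ N, IsEar C J D N ∧ IsWord C (N ∪ {e, y}) := by
    rintro x hx y hy hxe hye hxy ⟨N₁, h₁, hw₁⟩ ⟨N₂, h₂, hw₂⟩
    obtain ⟨z, hz⟩ := Finset.card_eq_one.1 (show (((D.erase e).erase x).erase y).card = 1 by
      rw [Finset.card_erase_of_mem (by simp [hy, hye, hxy.symm]),
        Finset.card_erase_of_mem (by simp [hx, hxe]), Finset.card_erase_of_mem heD, hDc])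
    have hz' : z ∈ ((D.erase e).erase x).erase y := by rw [hz]; simp
    simp only [Finset.mem_erase] at hz'
    refine not_codeSK_of_two_ears hC hNF hs h4 hD hDJ hDc (e := e) (x := x) (y := y) (z := z) ?_
      hxe.symm hye.symm hz'.2.2.1.symm hxy hz'.2.1.symm hz'.1.symm h₁ h₂ hw₁ hw₂
    rw [← hz, Finset.insert_erase (by simp [hy, hye, hxy.symm]),
      Finset.insert_erase (by simp [hx, hxe]), Finset.insert_erase heD]
  -- One ear meets `D` in a pair `{e, g}`; an ear separating `e` from this `g` meets it in another
  -- pair through `e`.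
  obtain ⟨g, hgD, hge, hga, hg⟩ := hear a hae.2 hae.1
  obtain ⟨k, hkD, hke, hkg, hk⟩ := hear g hgD hge
  exact htwo g hgD k hkD hge hke hkg.symm hg hk

/-- Either all circuits through `e` are triangles, or `e` has a series partner `f` in a four-element
circuit. With `e` gone, `f` is a coloop, and the strictly smaller shortening at `f` is covered by
`ih`. -/
theorem codeSK_erase_of_isSimpleOn [Finite ι] {e : ι} (heJ : e ∈ J) (hs : IsSimpleOn C J)
    (hNF : NoFano C) (hC : CodeSK C (J : Set ι))
    (ih : ∀ C' < C, NoFano C' → CodeSK C' (J : Set ι) →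
      CodeSK C' ((J.erase e : Finset ι) : Set ι)) :
    CodeSK C ((J.erase e : Finset ι) : Set ι) := by
  by_cases h3 : ∀ w ⊆ J, IsCircuit C w → e ∈ w → w.card = 3
  · exact codeSK_erase_of_triangles heJ hs h3 hC
  push Not at h3
  obtain ⟨D, hDJ, hD, heD, hD3⟩ := h3
  have hD4 := hD.card_le_four J.finite_toSet hC hNF (by exact_mod_cast hDJ)
  have := hs D hDJ hD.1 hD.2.1
  obtain ⟨f, hfD, hfe, z, hz, hzf, hz0⟩ := exists_series hC hNF hs hD hDJ (by omega) heD
  refine codeSK_of_coloop (f := f) (Finset.mem_erase.2 ⟨hfe, hDJ hfD⟩) hz hzf (fun i hi => ?_) ?_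
  · obtain ⟨hie, hiJ⟩ := Finset.mem_erase.1 hi.1
    exact hz0 i hiJ hie hi.2
  · refine ih _ ((shorten_le _ _).lt_of_ne fun h => ?_) (hNF.shorten _)
      (codeSK_shorten hC (by simpa using hDJ hfD))
    rw [← h] at hz
    have := hz.2 f rfl
    rw [hzf] at this
    exact one_ne_zero this

/-- Deleting a coordinate preserves strong Koszulness of codes without Fano minor. -/
theorem codeSK_erase [Finite ι] {e : ι} (heJ : e ∈ J) (hNF : NoFano C)
    (hC : CodeSK C (J : Set ι)) : CodeSK C ((J.erase e : Finset ι) : Set ι) := by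
  induction C using WellFoundedLT.induction generalizing J with
  | ind C ih =>
  by_cases hpar : (∀ x ∈ C, x e = 0) ∨ ∃ i ∈ J.erase e, ∀ x ∈ C, x e = x i
  · refine (codeSK_congr_coords (fun j hj => ?_) (fun j hj => ?_)).1 hC
    · by_cases hje : j = e
      · subst hje
        exact hpar
      · exact Or.inr ⟨j, Finset.mem_erase.2 ⟨hje, hj⟩, fun _ _ => rfl⟩
    · exact Or.inr ⟨j, Finset.mem_of_mem_erase hj, fun _ _ => rfl⟩
  push Not at hpar
  obtain ⟨⟨x₀, hx₀, hx₀e⟩, hpar⟩ := hpar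
  classical
  -- A smallest set of representatives of the nonzero coordinates that contains `e` is simple. As
  -- `e` is neither zero nor repeated, the other representatives still represent everything after
  -- its deletion.
  obtain ⟨Rep, hRep⟩ : ∃ Rep : Finset ι → Prop, ∀ K, Rep K ↔ (e ∈ K ∧ ∀ j ∈ J,
      (∀ x ∈ C, x j = 0) ∨ ∃ i ∈ K, ∀ x ∈ C, x j = x i) := ⟨_, fun _ => Iff.rfl⟩
  obtain ⟨K, hK, hmin⟩ := Finset.exists_min_image (J.powerset.filter Rep) Finset.card ⟨J, by
      rw [Finset.mem_filter, Finset.mem_powerset, hRep]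
      exact ⟨subset_rfl, heJ, fun j hj => Or.inr ⟨j, hj, fun _ _ => rfl⟩⟩⟩
  rw [Finset.mem_filter, Finset.mem_powerset, hRep] at hK
  obtain ⟨hKJ, heK, hKrep⟩ := hK
  have hmin' : ∀ k ∈ K, k ≠ e → ¬ ((∀ x ∈ C, x k = 0) ∨ ∃ i ∈ K, i ≠ k ∧ ∀ x ∈ C, x k = x i) := by
    intro k hk hke hkrep
    have := hmin (K.erase k) (by
      rw [Finset.mem_filter, Finset.mem_powerset, hRep]
      refine ⟨(Finset.erase_subset _ _).trans hKJ, Finset.mem_erase.2 ⟨hke.symm, heK⟩,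
        fun j hj => ?_⟩
      rcases hKrep j hj with h | ⟨i, hi, h⟩
      · exact Or.inl h
      · by_cases hik : i = k
        · subst hik
          rcases hkrep with h0 | ⟨l, hl, hli, h0⟩
          · exact Or.inl fun x hx => (h x hx).trans (h0 x hx)
          · exact Or.inr ⟨l, Finset.mem_erase.2 ⟨hli, hl⟩,
              fun x hx => (h x hx).trans (h0 x hx)⟩
        · exact Or.inr ⟨i, Finset.mem_erase.2 ⟨hik, hi⟩, h⟩)
    have := Finset.card_erase_lt_of_mem hk
    omega
  have hs : IsSimpleOn C K := by
    intro w hwK hw hwne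
    by_contra hcard
    have hpos := Finset.card_pos.2 hwne
    obtain h1 | h2 : w.card = 1 ∨ w.card = 2 := by omega
    · obtain ⟨k, rfl⟩ := Finset.card_eq_one.1 h1
      have hk0 : ∀ x ∈ C, x k = 0 := fun x hx => by simpa using hw x hx
      by_cases hke : k = e
      · subst hke
        exact hx₀e (hk0 x₀ hx₀)
      · exact hmin' k (hwK (by simp)) hke (Or.inl hk0)
    · obtain ⟨k, l, hkl, rfl⟩ := Finset.card_eq_two.1 h2
      have hrel : ∀ x ∈ C, x k = x l := fun x hx => by
        have := hw x hx
        rw [Finset.sum_pair hkl] at this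
        exact CharTwo.add_eq_zero.1 this
      by_cases hke : k = e
      · exact hmin' l (hwK (by simp)) (by rintro rfl; exact hkl hke)
          (Or.inr ⟨k, hwK (by simp), hkl, fun x hx => (hrel x hx).symm⟩)
      · exact hmin' k (hwK (by simp)) hke (Or.inr ⟨l, hwK (by simp), hkl.symm, hrel⟩)
  have hCK : CodeSK C (K : Set ι) :=
    (codeSK_congr_coords hKrep fun i hi => Or.inr ⟨i, hKJ hi, fun _ _ => rfl⟩).1 hC
  refine (codeSK_congr_coords (I := ((J.erase e : Finset ι) : Set ι)) (fun j hj => ?_)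
    (fun j hj => ?_)).1 (codeSK_erase_of_isSimpleOn heK hs hNF hCK
      fun C' hC' hNF' hSK' => ih C' hC' heK hNF' hSK')
  · obtain ⟨hje, hj⟩ := Finset.mem_erase.1 hj
    exact Or.inr ⟨j, Finset.mem_erase.2 ⟨hje, hKJ hj⟩, fun _ _ => rfl⟩
  · obtain ⟨hje, hjJ⟩ := Finset.mem_erase.1 hj
    refine (hKrep j hjJ).imp_right ?_
    rintro ⟨i, hi, h⟩
    refine ⟨i, Finset.mem_erase.2 ⟨?_, hi⟩, fun x hx => (h x hx).symm⟩
    rintro rfl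
    obtain ⟨x, hx, hne⟩ := hpar j hj
    exact hne (h x hx).symm

end DeletionTheorem
/-! ### Cut codes of graphs -/

section CutCode

variable {V : Type*}

/-- The map that sends a function on the vertices to its differences along all pairs. -/
def coboundary (V : Type*) : (V → ZMod 2) →ₗ[ZMod 2] (Sym2 V → ZMod 2) where
  toFun g := Sym2.lift ⟨fun i j => g i + g j, fun _ _ => add_comm _ _⟩
  map_add' g h := by
    ext e
    induction e with | _ i j => simp only [Sym2.lift_mk, Pi.add_apply]; ring
  map_smul' a g := by
    ext e
    induction e with | _ i j => simp [mul_add]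

theorem coboundary_mk (g : V → ZMod 2) (i j : V) : coboundary V g s(i, j) = g i + g j := rfl

/-- The cut code of the complete graph on `V`. -/
def cutCode (V : Type*) : Submodule (ZMod 2) (Sym2 V → ZMod 2) :=
  LinearMap.range (coboundary V)

theorem val_sum_fano (e a b : ZMod 2) :
    4 ∣ e.val + a.val + b.val + (e + a).val + (e + b).val + (a + b).val + (e + a + b).val := by
  revert e a b; decide

/-- Double counting over vertex stars after contraction: each of the seven coordinates, being
nonzero, lies in exactly two stars, for a total of fourteen. But a word is nonzero at none or four
of the seven functionals, so the total is divisible by four. -/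
theorem noFano_cutCode [Finite V] : NoFano (cutCode V) := by
  classical
  rintro F e a b ea eb ab eab hrel ⟨y₁, hy₁, e1, a1, b1⟩ ⟨y₂, hy₂, e2, a2, b2⟩
    ⟨y₃, hy₃, e3, a3, b3⟩
  -- The classes are the vertices after contracting the pairs in `F`; the coboundary of `g k` is the
  -- star of the class `k`.
  let r : Setoid V :=
    { r := fun i j => ∀ g, coboundary V g ∈ shorten F (cutCode V) → g i = g j
      iseqv := ⟨fun _ _ _ => rfl, fun h g hg => (h g hg).symm,
        fun h h' g hg => (h g hg).trans (h' g hg)⟩ }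
  have := Fintype.ofFinite (Quotient r)
  let g : Quotient r → V → ZMod 2 := fun k v => if Quotient.mk r v = k then 1 else 0
  have hg : ∀ k, coboundary V (g k) ∈ shorten F (cutCode V) := by
    refine fun k => ⟨⟨_, rfl⟩, fun c hc => ?_⟩
    induction c with | _ i j =>
    have hij : Quotient.mk r i = Quotient.mk r j :=
      Quotient.sound fun h hh => CharTwo.add_eq_zero.1 (hh.2 _ hc)
    rw [coboundary_mk]
    simp only [g, hij]
    exact CharTwo.add_self_eq_zero _
  have hsum : ∀ c : Sym2 V, (∃ y ∈ shorten F (cutCode V), y c ≠ 0) →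
      ∑ k, (coboundary V (g k) c).val = 2 := by
    rintro c ⟨y, hy, hyc⟩
    obtain ⟨h, rfl⟩ := hy.1
    induction c with | _ i j =>
    have hij : Quotient.mk r i ≠ Quotient.mk r j := fun hij =>
      hyc (CharTwo.add_eq_zero.2 (Quotient.exact hij h hy))
    have : ∀ k, (coboundary V (g k) s(i, j)).val =
        (if Quotient.mk r i = k then 1 else 0) + if Quotient.mk r j = k then 1 else 0 := by
      intro k
      rw [coboundary_mk]
      simp only [g]
      by_cases h1 : Quotient.mk r i = k <;> by_cases h2 : Quotient.mk r j = k
      · exact absurd (h1.trans h2.symm) hij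
      all_goals simp [h1, h2, ZMod.val_one]
    simp [this, Finset.sum_add_distrib]
  have hdvd : 4 ∣ ∑ k, ((coboundary V (g k) e).val + (coboundary V (g k) a).val +
      (coboundary V (g k) b).val + (coboundary V (g k) ea).val + (coboundary V (g k) eb).val +
      (coboundary V (g k) ab).val + (coboundary V (g k) eab).val) := by
    refine Finset.dvd_sum fun k _ => ?_
    obtain ⟨h1, h2, h3, h4⟩ := hrel _ (hg k)
    rw [h1, h2, h3, h4]
    exact val_sum_fano _ _ _
  have hr₁ := hrel _ hy₁
  have hr₂ := hrel _ hy₂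
  simp only [Finset.sum_add_distrib] at hdvd
  rw [hsum e ⟨y₁, hy₁, by simp [e1]⟩, hsum a ⟨y₂, hy₂, by simp [a2]⟩, hsum b ⟨y₃, hy₃, by simp [b3]⟩,
    hsum ea ⟨y₁, hy₁, by simp [hr₁.1, e1, a1]⟩, hsum eb ⟨y₁, hy₁, by simp [hr₁.2.1, e1, b1]⟩,
    hsum ab ⟨y₂, hy₂, by simp [hr₂.2.2.1, a2, b2]⟩,
    hsum eab ⟨y₁, hy₁, by simp [hr₁.2.2.2, e1, a1, b1]⟩] at hdvd
  omega

open Classical in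
/-- The cut vector of the partition `A | Aᶜ`. -/
noncomputable def cutVec (A : Set V) (e : Sym2 V) : ℕ := if IsCutBy A e then 1 else 0

theorem isCutBy_mk {A : Set V} {i j : V} : IsCutBy A s(i, j) ↔ ¬ (i ∈ A ↔ j ∈ A) := by
  constructor
  · rintro ⟨k, l, h, hk, hl⟩
    rcases Sym2.eq_iff.1 h with ⟨rfl, rfl⟩ | ⟨rfl, rfl⟩ <;> tauto
  · intro h
    by_cases hi : i ∈ A
    · exact ⟨i, j, rfl, hi, by tauto⟩
    · exact ⟨j, i, Sym2.eq_swap, by tauto, hi⟩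

theorem cutVec_mk_congr {W : Type*} {A : Set V} {B : Set W} {i j : V} {k l : W}
    (h : i ∈ A ↔ k ∈ B) (h' : j ∈ A ↔ l ∈ B) : cutVec A s(i, j) = cutVec B s(k, l) := by
  have : IsCutBy A s(i, j) ↔ IsCutBy B s(k, l) := by rw [isCutBy_mk, isCutBy_mk, h, h']
  classical
  exact if_congr this rfl rfl

theorem cutVec_eq_zero {A : Set V} {i j : V} : cutVec A s(i, j) = 0 ↔ (i ∈ A ↔ j ∈ A) := by
  simp [cutVec, isCutBy_mk]

/-- The combinatorial form of strong Koszulness of the toric ring of the cut ideal. -/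
def CutSK (G : SimpleGraph V) : Prop :=
  StronglyKoszulOn (cutVec (V := V)) Set.univ G.edgeSet

theorem cutSK_iff_codeSK (G : SimpleGraph V) : CutSK G ↔ CodeSK (cutCode V) G.edgeSet := by
  classical
  have key : ∀ (A : Set V) (e : Sym2 V),
      cutVec A e = bits (coboundary V (A.indicator 1)) e := by
    intro A e
    induction e with | _ i j =>
    simp only [cutVec, isCutBy_mk, bits, coboundary_mk, Set.indicator_apply, Pi.one_apply]
    by_cases hi : i ∈ A <;> by_cases hj : j ∈ A <;> simp [hi, hj, ZMod.val_one]
    decide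
  refine stronglyKoszulOn_transfer (fun A => coboundary V (A.indicator 1)) (fun A _ => ⟨_, rfl⟩) ?_
    (fun e he => Or.inr ⟨e, he, fun A _ => key A e⟩) fun e he => Or.inr ⟨e, he, fun A _ => key A e⟩
  rintro _ ⟨g, rfl⟩
  refine ⟨{v | g v = 1}, Set.mem_univ _, ?_⟩
  dsimp only
  congr 1
  ext v
  rcases zmod_two_eq (g v) with h | h <;> simp [h]

theorem CutSK.deleteEdge [Finite V] {G : SimpleGraph V} (h : CutSK G) (e : Sym2 V) :
    CutSK (G.deleteEdges {e}) := by
  classical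
  by_cases he : e ∈ G.edgeSet
  · rw [cutSK_iff_codeSK] at h ⊢
    have hfin : G.edgeSet.Finite := Set.toFinite _
    have := codeSK_erase (J := hfin.toFinset) (hfin.mem_toFinset.2 he) noFano_cutCode
      (by rwa [hfin.coe_toFinset])
    rwa [Finset.coe_erase, hfin.coe_toFinset, ← SimpleGraph.edgeSet_deleteEdges] at this
  · rwa [SimpleGraph.deleteEdges_eq_self.2 (by simpa using he)]

theorem CutSK.deleteEdges [Finite V] {G : SimpleGraph V} (h : CutSK G) (s : Set (Sym2 V)) :
    CutSK (G.deleteEdges s) := by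
  induction s, Set.toFinite s using Set.Finite.induction_on with
  | empty => simpa using h
  | @insert e s _ _ ih =>
    have := ih.deleteEdge e
    rwa [SimpleGraph.deleteEdges_deleteEdges, Set.union_singleton] at this

/-- Once the edges at `x` are deleted, membership of `x` in a part affects no coordinate. -/
theorem CutSK.deleteVertex [Finite V] {G : SimpleGraph V} (h : CutSK G) (x : V) :
    CutSK (G.induce {x}ᶜ) := by
  refine (stronglyKoszulOn_transfer
    (fun A : Set V => (Subtype.val ⁻¹' A : Set ({x}ᶜ : Set V))) (Set.mapsTo_univ _ _) ?_ ?_ ?_).1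
    (h.deleteEdges {e | x ∈ e})
  · intro B _
    exact ⟨Subtype.val '' B, Set.mem_univ _, Set.preimage_image_eq _ Subtype.val_injective⟩
  · intro e he
    induction e with | _ i j =>
    simp only [SimpleGraph.mem_edgeSet, SimpleGraph.deleteEdges_adj, Set.mem_ofPred_eq,
      Sym2.mem_iff, not_or] at he
    exact Or.inr ⟨s(⟨i, fun h => he.2.1 h.symm⟩, ⟨j, fun h => he.2.2 h.symm⟩), he.1,
      fun A _ => cutVec_mk_congr Iff.rfl Iff.rfl⟩
  · intro e he
    induction e with | _ i j =>
    refine Or.inr ⟨s(i, j), ?_, fun A _ => cutVec_mk_congr Iff.rfl Iff.rfl⟩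
    simp only [SimpleGraph.mem_edgeSet, SimpleGraph.deleteEdges_adj, Set.mem_ofPred_eq,
      Sym2.mem_iff, not_or]
    exact ⟨he, fun h => i.2 h.symm, fun h => j.2 h.symm⟩

theorem contract_adj {G : SimpleGraph V} {x y : V} {a b : {v : V // v ≠ y}} :
    (contract G x y).Adj a b ↔ a ≠ b ∧ (G.Adj a b ∨ ((a : V) = x ∧ G.Adj y b) ∨
      ((b : V) = x ∧ G.Adj y a)) := by
  rw [contract, SimpleGraph.fromRel_adj, G.adj_comm b a]
  tauto

/-- The partitions that do not cut `xy` form a face and are those of the contracted vertex set.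
Loops become zero coordinates and parallel edges become repeated ones. -/
theorem CutSK.contract {G : SimpleGraph V} (h : CutSK G) {x y : V} (hxy : G.Adj x y) :
    CutSK (contract G x y) := by
  refine (stronglyKoszulOn_transfer
    (fun A : Set V => (Subtype.val ⁻¹' A : Set {v : V // v ≠ y})) (Set.mapsTo_univ _ _) ?_ ?_ ?_).1
    (h.face (F := {s(x, y)}) (by simpa using hxy))
  · intro B _
    refine ⟨{v | (∃ hv : v ≠ y, ⟨v, hv⟩ ∈ B) ∨ v = y ∧ ⟨x, hxy.ne⟩ ∈ B}, ⟨Set.mem_univ _, ?_⟩, ?_⟩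
    · simp [cutVec_eq_zero, hxy.ne]
    · ext ⟨v, hv⟩
      simp [hv]
  · have hy : ∀ k, G.Adj y k → (∀ A ∈ {A | A ∈ Set.univ ∧ ∀ i ∈ ({s(x, y)} : Set (Sym2 V)),
        cutVec A i = 0}, cutVec A s(y, k) = 0) ∨ ∃ e' ∈ (CutToric.contract G x y).edgeSet,
        ∀ A ∈ {A | A ∈ Set.univ ∧ ∀ i ∈ ({s(x, y)} : Set (Sym2 V)), cutVec A i = 0},
        cutVec A s(y, k) = cutVec (Subtype.val ⁻¹' A : Set {v : V // v ≠ y}) e' := by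
      intro k hk
      by_cases hkx : k = x
      · subst hkx
        left
        rintro A ⟨-, hA⟩
        have := cutVec_eq_zero.1 (hA _ rfl)
        exact cutVec_eq_zero.2 this.symm
      · right
        refine ⟨s(⟨x, hxy.ne⟩, ⟨k, hk.ne'⟩), ?_, ?_⟩
        · rw [SimpleGraph.mem_edgeSet, contract_adj]
          exact ⟨fun h => hkx (congrArg Subtype.val h).symm, Or.inr (Or.inl ⟨rfl, hk⟩)⟩
        · rintro A ⟨-, hA⟩
          exact cutVec_mk_congr (cutVec_eq_zero.1 (hA _ rfl)).symm Iff.rfl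
    intro e he
    induction e with | _ i j =>
    by_cases hi : i = y
    · subst hi
      exact hy j he
    by_cases hj : j = y
    · subst hj
      rw [Sym2.eq_swap (a := i)]
      exact hy i (G.adj_symm he)
    · refine Or.inr ⟨s(⟨i, hi⟩, ⟨j, hj⟩), ?_, fun A _ => cutVec_mk_congr Iff.rfl Iff.rfl⟩
      rw [SimpleGraph.mem_edgeSet, contract_adj]
      exact ⟨fun h => (G.ne_of_adj he) (congrArg Subtype.val h), Or.inl he⟩
  · intro e he
    right
    induction e with | _ a b =>
    rw [SimpleGraph.mem_edgeSet, contract_adj] at he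
    rcases he.2 with h | ⟨ha, h⟩ | ⟨hb, h⟩
    · exact ⟨s(a, b), h, fun A _ => cutVec_mk_congr Iff.rfl Iff.rfl⟩
    · refine ⟨s(y, b), h, ?_⟩
      rintro A ⟨-, hA⟩
      refine cutVec_mk_congr ?_ Iff.rfl
      rw [Set.mem_preimage, ha]
      exact (cutVec_eq_zero.1 (hA _ rfl)).symm
    · refine ⟨s(a, y), G.adj_symm h, ?_⟩
      rintro A ⟨-, hA⟩
      refine cutVec_mk_congr Iff.rfl ?_
      rw [Set.mem_preimage, hb]
      exact (cutVec_eq_zero.1 (hA _ rfl)).symm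

theorem CutSK.of_iso {W : Type*} {G : SimpleGraph V} {H : SimpleGraph W} (h : CutSK G)
    (f : H ≃g G) : CutSK H := by
  refine (stronglyKoszulOn_transfer (fun A : Set V => (f ⁻¹' A : Set W)) (Set.mapsTo_univ _ _)
    ?_ ?_ ?_).1 h
  · intro B _
    exact ⟨f '' B, Set.mem_univ _, Set.preimage_image_eq _ f.injective⟩
  · intro e he
    induction e with | _ i j =>
    refine Or.inr ⟨s(f.symm i, f.symm j), f.symm.map_adj_iff.2 he, fun A _ =>
      cutVec_mk_congr ?_ ?_⟩ <;> simp
  · intro e he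
    induction e with | _ i j =>
    exact Or.inr ⟨s(f i, f j), f.map_adj_iff.2 he, fun A _ => cutVec_mk_congr Iff.rfl Iff.rfl⟩

theorem IsMinor.cutSK {W : Type*} {G : SimpleGraph V} {H : SimpleGraph W}
    (hHG : IsMinor H G) (hV : Finite V) (hG : CutSK G) : CutSK H := by
  induction hHG with
  | iso f => exact hG.of_iso f
  | deleteEdge e _ _ ih => exact ih hV (hG.deleteEdge e)
  | contractEdge x y hxy _ ih => exact ih Subtype.finite (hG.contract hxy)
  | deleteVertex x _ ih => exact ih Subtype.finite (hG.deleteVertex x)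

end CutCode

/-! ### The toric ring and its monomials -/

section ToricRing

open MvPolynomial

variable {K : Type*} [Field K] {V : Type*} [Fintype V] {G : SimpleGraph V}

open Classical in
/-- The exponent of the product of the monomials `u_{A|B}` over a multiset of sets `A`. -/
noncomputable def cutExponent (G : SimpleGraph V) : Multiset (Set V) →+ (Option G.edgeSet →₀ ℕ) :=
  Multiset.sumAddMonoidHom.comp (Multiset.mapAddMonoidHom fun A => Finsupp.single none 1 +
    ∑ e ∈ Finset.univ.filter (fun e : G.edgeSet => IsCutBy A e.1), Finsupp.single (some e) 1)

open Classical in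
theorem cutExponent_singleton (A : Set V) : cutExponent G {A} = Finsupp.single none 1 +
    ∑ e ∈ Finset.univ.filter (fun e : G.edgeSet => IsCutBy A e.1), Finsupp.single (some e) 1 := by
  simp [cutExponent]

theorem cutExponent_none (M : Multiset (Set V)) : cutExponent G M none = M.card := by
  induction M using Multiset.induction with
  | empty => simp
  | cons A M ih =>
    rw [← Multiset.singleton_add, map_add, Finsupp.add_apply, ih, cutExponent_singleton]
    simp [add_comm]

theorem cutExponent_some (M : Multiset (Set V)) (e : G.edgeSet) :
    cutExponent G M (some e) = (M.map fun A => cutVec A e.1).sum := by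
  classical
  induction M using Multiset.induction with
  | empty => simp
  | cons A M ih =>
    rw [← Multiset.singleton_add, map_add, Finsupp.add_apply, ih, cutExponent_singleton]
    have : (fun c : G.edgeSet => (Finsupp.single (some c) 1 : Option G.edgeSet →₀ ℕ) (some e)) =
        fun c => if c = e then 1 else 0 := by
      ext c
      simp [Finsupp.single_apply]
    simp [cutVec, this]

theorem sameSum_iff_cutExponent {M N : Multiset (Set V)} :
    SameSum (cutVec (V := V)) G.edgeSet M N ↔ cutExponent G M = cutExponent G N := by
  constructor
  · rintro ⟨h, h'⟩
    ext (_ | e)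
    · simpa only [cutExponent_none] using h
    · simpa only [cutExponent_some] using h' e.1 e.2
  · intro h
    refine ⟨by rw [← cutExponent_none (G := G), h, cutExponent_none], fun e he => ?_⟩
    rw [← cutExponent_some M ⟨e, he⟩, h, cutExponent_some]

variable (K G) in
/-- The product of the generators `u_{A|B}` over a multiset of sets `A`. -/
noncomputable def cutProd (M : Multiset (Set V)) : toricRing K G :=
  (M.map (cutGen K G)).prod

theorem coe_cutGen (A : Set V) :
    (cutGen K G A : MvPolynomial (Option G.edgeSet) K) = monomial (cutExponent G {A}) 1 := by
  have : (cutGen K G A : MvPolynomial (Option G.edgeSet) K) = cutMonomial K G A :=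
    aeval_X _ _
  rw [this, cutMonomial, cutExponent_singleton, ← mul_one (1 : K), ← monomial_mul,
    monomial_sum_one]
  rfl

theorem coe_cutProd (M : Multiset (Set V)) :
    (cutProd K G M : MvPolynomial (Option G.edgeSet) K) = monomial (cutExponent G M) 1 := by
  induction M using Multiset.induction with
  | empty => simp [cutProd]
  | cons A M ih =>
    rw [← Multiset.singleton_add, map_add, ← mul_one (1 : K), ← monomial_mul, ← ih, ← coe_cutGen]
    simp [cutProd]

theorem cutProd_cons (A : Set V) (M : Multiset (Set V)) :
    cutProd K G (A ::ₘ M) = cutGen K G A * cutProd K G M := by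
  simp [cutProd]

theorem cutProd_eq_cutProd {M N : Multiset (Set V)} :
    cutProd K G M = cutProd K G N ↔ SameSum (cutVec (V := V)) G.edgeSet M N := by
  rw [Subtype.ext_iff, coe_cutProd, coe_cutProd, sameSum_iff_cutExponent]
  exact monomial_left_inj one_ne_zero

theorem exists_cutExponent_eq (x : toricRing K G) {n : Option G.edgeSet →₀ ℕ}
    (hn : n ∈ x.1.support) : ∃ M, cutExponent G M = n := by
  classical
  obtain ⟨_, p, rfl⟩ := x
  induction p using MvPolynomial.induction_on generalizing n with
  | C a =>
    refine ⟨0, ?_⟩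
    have hC : cutMap K G (C a) = monomial 0 a := by simp [cutMap]
    dsimp only at hn
    change n ∈ (cutMap K G (C a)).support at hn
    rw [hC] at hn
    have := support_monomial_subset hn
    simpa [eq_comm] using this
  | add p q hp hq =>
    dsimp only at hn hp hq
    rw [map_add] at hn
    rcases Finset.mem_union.1 (support_add hn) with h | h
    exacts [hp h, hq h]
  | mul_X p A hp =>
    dsimp only at hn hp
    rw [map_mul] at hn
    obtain ⟨m, hm, k, hk, rfl⟩ := Finset.mem_add.1 (support_mul _ _ hn)
    obtain ⟨M, rfl⟩ := hp hm
    have hA : (cutMap K G) (X A) = (cutGen K G A : MvPolynomial _ K) := rfl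
    change k ∈ (cutMap K G (X A)).support at hk
    rw [hA, coe_cutGen] at hk
    have := support_monomial_subset hk
    rw [Finset.mem_singleton] at this
    exact ⟨M + {A}, by rw [map_add, this]⟩

theorem exists_cutExponent_cons_eq {x : toricRing K G} {A : Set V}
    (hx : x ∈ Ideal.span {cutGen K G A}) {n : Option G.edgeSet →₀ ℕ} (hn : n ∈ x.1.support) :
    ∃ M, cutExponent G (A ::ₘ M) = n := by
  classical
  obtain ⟨y, rfl⟩ := Ideal.mem_span_singleton'.1 hx
  rw [MulMemClass.coe_mul] at hn
  obtain ⟨m, hm, k, hk, rfl⟩ := Finset.mem_add.1 (support_mul _ _ hn)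
  obtain ⟨M, rfl⟩ := exists_cutExponent_eq y hm
  rw [coe_cutGen] at hk
  have := support_monomial_subset hk
  rw [Finset.mem_singleton] at this
  exact ⟨M, by rw [← Multiset.singleton_add, map_add, this, add_comm]⟩

/-- The exponent of `s` records the degree. -/
theorem apply_none_of_mem_span_sq {x : toricRing K G}
    (hx : x ∈ (Submodule.span K (Set.range (cutGen K G))) ^ 2) {n : Option G.edgeSet →₀ ℕ}
    (hn : n ∈ x.1.support) : n none = 2 := by
  classical
  have hone : ∀ y ∈ Submodule.span K (Set.range (cutGen K G)), ∀ m ∈ y.1.support, m none = 1 := by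
    intro y hy
    induction hy using Submodule.span_induction with
    | mem y hy =>
      obtain ⟨A, rfl⟩ := hy
      intro m hm
      rw [coe_cutGen] at hm
      have := support_monomial_subset hm
      rw [Finset.mem_singleton] at this
      rw [this, cutExponent_none, Multiset.card_singleton]
    | zero => simp
    | add y z _ _ hy hz =>
      intro m hm
      rcases Finset.mem_union.1 (support_add hm) with h | h
      exacts [hy m h, hz m h]
    | smul a y _ hy => exact fun m hm => hy m (support_smul hm)
  rw [pow_two] at hx
  induction hx using Submodule.mul_induction_on' generalizing n with
  | mem_mul_mem y hy z hz =>
    rw [MulMemClass.coe_mul] at hn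
    obtain ⟨m, hm, k, hk, rfl⟩ := Finset.mem_add.1 (support_mul _ _ hn)
    rw [Finsupp.add_apply, hone y hy m hm, hone z hz k hk]
  | add y _ z _ hy hz =>
    rcases Finset.mem_union.1 (support_add hn) with h | h
    exacts [hy h, hz h]

/-- The monomial of `A ::ₘ M` lies in both ideals, so it is a multiple of a monomial occurring in
some quadratic element of the intersection. Such a monomial factors through both generators, which
yields `p` and `q`. -/
theorem cutSK_of_toricRingStronglyKoszul (h : ToricRingStronglyKoszul K G) : CutSK G := by
  classical
  intro A _ B _ M N _ _ hM hS
  -- Different sets, such as `A` and `Aᶜ`, can give the same generator; the definition of strong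
  -- Koszulness is then silent, and `q = p` works.
  by_cases hAB : cutGen K G A = cutGen K G B
  · obtain ⟨p, hp⟩ := Multiset.exists_mem_of_ne_zero hM
    obtain ⟨L, rfl⟩ := Multiset.exists_cons_of_mem hp
    refine ⟨p, Set.mem_univ _, p, Set.mem_univ _, L, fun _ _ => Set.mem_univ _, ?_,
      SameSum.refl _ _ _⟩
    rw [← cutProd_eq_cutProd (K := K)]
    simp [cutProd, hAB]
  have hgen : Ideal.span _ = _ := h _ ⟨A, rfl⟩ _ ⟨B, rfl⟩ hAB
  have hw : cutProd K G (A ::ₘ M) ∈ Ideal.span {cutGen K G A} ⊓ Ideal.span {cutGen K G B} := by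
    refine ⟨Ideal.mem_span_singleton.2 ⟨_, cutProd_cons A M⟩,
      Ideal.mem_span_singleton.2 ⟨cutProd K G N, ?_⟩⟩
    rw [cutProd_eq_cutProd.2 hS, cutProd_cons]
  rw [← hgen] at hw
  have key : ∀ n ∈ (cutProd K G (A ::ₘ M)).1.support, ∃ p q L,
      cutExponent G ({A, p} + L) = n ∧ cutExponent G {A, p} = cutExponent G {B, q} := by
    clear hS
    generalize cutProd K G (A ::ₘ M) = w at hw ⊢
    induction hw using Submodule.span_induction with
    | mem y hy =>
      intro n hn
      have h2 := apply_none_of_mem_span_sq hy.2 hn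
      obtain ⟨P, rfl⟩ := exists_cutExponent_cons_eq hy.1.1 hn
      obtain ⟨Q, hQ⟩ := exists_cutExponent_cons_eq hy.1.2 hn
      have hQ2 := h2
      rw [← hQ] at hQ2
      rw [cutExponent_none, Multiset.card_cons] at h2 hQ2
      obtain ⟨p, rfl⟩ := Multiset.card_eq_one.1 (show P.card = 1 by omega)
      obtain ⟨q, rfl⟩ := Multiset.card_eq_one.1 (show Q.card = 1 by omega)
      exact ⟨p, q, 0, by simp, hQ.symm⟩
    | zero => simp
    | add y z _ _ hy hz =>
      intro n hn
      rcases Finset.mem_union.1 (support_add hn) with h | h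
      exacts [hy n h, hz n h]
    | smul a y _ hy =>
      intro n hn
      rw [smul_eq_mul, MulMemClass.coe_mul] at hn
      obtain ⟨m, hm, k, hk, rfl⟩ := Finset.mem_add.1 (support_mul _ _ hn)
      obtain ⟨L', rfl⟩ := exists_cutExponent_eq a hm
      obtain ⟨p, q, L, rfl, hpq⟩ := hy k hk
      exact ⟨p, q, L + L', by rw [← add_assoc, map_add _ _ L', add_comm], hpq⟩
  obtain ⟨p, q, L, hL, hpq⟩ := key (cutExponent G (A ::ₘ M)) (by
    rw [coe_cutProd, mem_support_iff, coeff_monomial, if_pos rfl]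
    exact one_ne_zero)
  refine ⟨p, Set.mem_univ _, q, Set.mem_univ _, L, fun _ _ => Set.mem_univ _,
    sameSum_iff_cutExponent.2 hpq, sameSum_iff_cutExponent.2 ?_⟩
  have : ({A, p} + L : Multiset (Set V)) = {A} + p ::ₘ L := by
    rw [Multiset.insert_eq_cons, Multiset.cons_add, Multiset.singleton_add, Multiset.singleton_add]
  rw [this, ← Multiset.singleton_add A M, map_add, map_add] at hL
  exact (add_left_cancel hL).symm

/-- Every monomial of an element of the intersection is divisible by both generators, so the
exchange makes it a multiple of a quadratic monomial in both ideals. -/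
theorem toricRingStronglyKoszul_of_cutSK (h : CutSK G) : ToricRingStronglyKoszul K G := by
  rintro _ ⟨A, rfl⟩ _ ⟨B, rfl⟩ hAB
  refine le_antisymm (Ideal.span_le.2 fun x hx => hx.1) fun x hx => ?_
  have key : ∀ n ∈ x.1.support, ∃ M, cutExponent G M = n ∧ cutProd K G M ∈
      Ideal.span {x | x ∈ Ideal.span {cutGen K G A} ⊓ Ideal.span {cutGen K G B} ∧
        x ∈ (Submodule.span K (Set.range (cutGen K G))) ^ 2} := by
    intro n hn
    obtain ⟨M, rfl⟩ := exists_cutExponent_cons_eq hx.1 hn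
    obtain ⟨N, hN⟩ := exists_cutExponent_cons_eq hx.2 hn
    have hS := sameSum_iff_cutExponent.2 hN.symm
    -- `M = 0` would mean that the two generators coincide.
    obtain ⟨p, -, q, -, L, -, h1, h2⟩ := h A (Set.mem_univ _) B (Set.mem_univ _) M N
      (fun _ _ => Set.mem_univ _) (fun _ _ => Set.mem_univ _) (by
        rintro rfl
        have hN0 : N = 0 := by simpa using hS.1
        subst hN0
        refine hAB ?_
        have := (cutProd_eq_cutProd (K := K)).2 hS
        simpa [cutProd] using this) hS
    refine ⟨_, rfl, ?_⟩
    have hM : cutProd K G (A ::ₘ M) = cutProd K G L * cutProd K G {A, p} := by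
      rw [cutProd_cons, cutProd_eq_cutProd.2 h2]
      simp only [cutProd, Multiset.map_cons, Multiset.prod_cons, Multiset.insert_eq_cons,
        Multiset.map_singleton, Multiset.prod_singleton]
      ring
    rw [hM]
    refine Ideal.mul_mem_left _ _ (Ideal.subset_span ⟨⟨?_, ?_⟩, ?_⟩)
    · exact Ideal.mem_span_singleton.2 ⟨_, cutProd_cons A {p}⟩
    · rw [cutProd_eq_cutProd.2 h1]
      exact Ideal.mem_span_singleton.2 ⟨_, cutProd_cons B {q}⟩
    · rw [pow_two]
      have : cutProd K G {A, p} = cutGen K G A * cutGen K G p := by simp [cutProd]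
      rw [this]
      exact Submodule.mul_mem_mul (Submodule.subset_span ⟨A, rfl⟩) (Submodule.subset_span ⟨p, rfl⟩)
  choose! t ht1 ht2 using key
  have hxt : x = ∑ n ∈ x.1.support, x.1.coeff n • cutProd K G (t n) := by
    apply Subtype.ext
    rw [AddSubmonoidClass.coe_finsetSum]
    conv_lhs => rw [← support_sum_monomial_coeff x.1]
    refine Finset.sum_congr rfl fun n hn => ?_
    rw [SetLike.val_smul, coe_cutProd, ht1 n hn, smul_monomial, smul_eq_mul, mul_one]
  rw [hxt]
  exact Submodule.sum_mem _ fun n hn => Submodule.smul_of_tower_mem _ _ (ht2 n hn)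

end ToricRing

end CutToric

theorem mainTheorem7 {K : Type*} [Field K] {V W : Type*} [Fintype V] [Fintype W]
    (G : SimpleGraph V) (H : SimpleGraph W) (hHG : CutToric.IsMinor H G)
    (hG : CutToric.ToricRingStronglyKoszul K G) :
    CutToric.ToricRingStronglyKoszul K H :=
  CutToric.toricRingStronglyKoszul_of_cutSK
    (hHG.cutSK inferInstance (CutToric.cutSK_of_toricRingStronglyKoszul hG))
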